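/- Let $0\le h<k$ and $k+1+h\le n$ be integers, and let $M\in(0,1)^{n\times n}$ satisfy $M_{ij}=1-M_{ji}$ for all $i,j$. A comparison of $i$ with $j\ne i$ is won by $i$ with probability $M_{ij}$, and all comparisons are independent. Let $\tau_i=\frac1{n-1}\sum_{j\ne i}M_{ij}$, let $\pi$ be any permutation with $\tau_{\pi(1)}\ge\dots\ge\tau_{\pi(n)}$, and let $S_1=\{\pi(1),\dots,\pi(k)\}$, $S_2=\{\pi(k+1),\dots,\pi(n)\}$ and $\Delta_{r,s}=\tau_{\pi(r)}-\tau_{\pi(s)}$. A partition $\widehat S_1,\widehat S_2$ of the items with $|\widehat S_\ell|=|S_\ell|$ is $h$-Hamming-accurate if $|\widehat S_\ell\,\triangle\,S_\ell|\le 2h$ for $\ell=1,2$. The Hamming-LUCB algorithm with confidence parameter $\delta$ uses $\alpha(u)=\sqrt{\beta(u,\delta/n)/(2u)}$, where either $0<\delta<0.0005$ and $\beta(u,\delta')=\log(1/\delta')+0.75\log\log(1/\delta')+1.5\log(1+\log(u/2))$, or $0<\delta<1$ and $\beta(u,\delta')=2\log(125\log(1.12u)/\delta')$. To sample an item $i$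 means to compare it with a uniformly random other item. The algorithm maintains for each item $i$ the number $T_i$ of times it has been sampled and the fraction $\widehat\tau_i$ of these comparisons that $i$ won; write $\alpha_i=\alpha(T_i)$. It first samples every item once. In each round it takes a permutation $(\cdot)$ with $\widehat\tau_{(1)}\ge\dots\ge\widehat\tau_{(n)}$, $$d_1\in\operatorname*{arg\,min}_{i\in\{(1),\dots,(k-h)\}}(\widehat\tau_i-\alpha_i),\qquad d_2\in\operatorname*{arg\,max}_{i\in\{(k+1+h),\dots,(n)\}}(\widehat\tau_i+\alpha_i).$$ If $\widehat\tau_{d_1}-\alpha_{d_1}\ge\widehat\tau_{d_2}+\alpha_{d_2}$, it stops and returns $\widehat S_1=\{(1),\dots,(k)\}$, $\widehat S_2=\{(k+1),\dots,(n)\}$. Otherwise it samples the two items $$b_1\in\operatorname*{arg\,max}_{i\in\{d_1,(k-h+1),\dots,(k)\}}\alpha_i,\qquad b_2\in\operatorname*{arg\,max}_{i\in\{d_2,(k+1),\dots,(k+h)\}}\alpha_i .$$ Ties are broken by an arbitrary rule, which may depend on the round and on the current $T_i,\widehat\tau_i$. Theorem. There is a universal constant $C>0$ such that for all such $n,k,h,M,\pi$,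 all $\delta$ and $\beta$ as above and every tie-breaking rule: (1) the probability that the algorithm stops and returns a partition that is not $h$-Hamming-accurate is at most $\delta$; (2) if $\Delta_{k-h,k+1+h}>0$, then with probability at least $1-\delta$ the algorithm stops and returns an $h$-Hamming-accurate partition; and (3) if $\Delta_{k-h,k+1+h}>0$, then with probability at least $1-\delta$ the algorithm stops after at most $$C\,\log\frac n\delta\left(\sum_{i=1}^{k-h}\frac{\log(2\log(2/\Delta_{i,k+1+h}))}{\Delta_{i,k+1+h}^{2}}+\sum_{i=k+1+h}^{n}\frac{\log(2\log(2/\Delta_{k-h,i}))}{\Delta_{k-h,i}^{2}}+2h\,\frac{\log(2\log(2/\Delta_{k-h,k+1+h}))}{\Delta_{k-h,k+1+h}^{2}}\right)$$ comparisons. -/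

import Mathlib

open MeasureTheory

noncomputable section

namespace HammingLUCB

/-! ### Pairwise comparison matrices, scores, rankings -/

/-- The pairwise comparison matrices with entries in `(0,1)`, `M i j = 1 - M j i`, and all entries
at least `pmin`. -/
def comparisonClass (n : ℕ) (pmin : ℝ) : Set (Matrix (Fin n) (Fin n) ℝ) :=
  {M | ∀ i j, 0 < M i j ∧ M i j < 1 ∧ M i j = 1 - M j i ∧ pmin ≤ M i j}

/-- The (Borda) score of item `i`: the probability that it beats a uniformly random other item. -/
def score {n : ℕ} (M : Matrix (Fin n) (Fin n) ℝ) (i : Fin n) : ℝ :=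
  1 / ((n : ℝ) - 1) * ∑ j ∈ Finset.univ.erase i, M i j

/-- `σ` lists the items in non-increasing order of the values `f`; the item of rank `r + 1` is
`σ r`. With ties there are several such permutations. -/
def IsSorting {n : ℕ} (f : Fin n → ℝ) (σ : Equiv.Perm (Fin n)) : Prop :=
  Antitone fun r => f (σ r)

/-- The items `{σ(a), …, σ(b)}` of ranks `a, …, b`, with ranks counted from `1` as usual. -/
def ranked {n : ℕ} (σ : Equiv.Perm (Fin n)) (a b : ℕ) : Finset (Fin n) :=
  (Finset.univ.filter fun r : Fin n => a ≤ r.val + 1 ∧ r.val + 1 ≤ b).image σ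

/-- The Hamming distance between two sets of items. -/
def hammingDistance {n : ℕ} (S S' : Finset (Fin n)) : ℕ :=
  ((S ∪ S') \ (S ∩ S')).card

/-- The partition `A₁, A₂` is an `h`-Hamming-accurate estimate of the partition
`S₁ = {π(1), …, π(k)}`, `S₂ = {π(k+1), …, π(n)}`. -/
def HammingAccurate {n : ℕ} (k h : ℕ) (π : Equiv.Perm (Fin n)) (A₁ A₂ : Finset (Fin n)) : Prop :=
  (A₁.card = (ranked π 1 k).card ∧ A₂.card = (ranked π (k + 1) n).card) ∧
    hammingDistance A₁ (ranked π 1 k) ≤ 2 * h ∧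
    hammingDistance A₂ (ranked π (k + 1) n) ≤ 2 * h

/-! ### The random comparisons -/

/-- The law of one comparison of item `i` with an opponent `j` that is uniform on the other items:
the opponent `j`, and whether `i` wins, which has probability `M i j` given `j`. -/
def comparisonLaw {n : ℕ} (M : Matrix (Fin n) (Fin n) ℝ) (i : Fin n) : Measure (Fin n × Bool) :=
  ∑ j ∈ Finset.univ.erase i, ENNReal.ofReal (1 / ((n : ℝ) - 1)) •
    (ENNReal.ofReal (M i j) • Measure.dirac (j, true) +
      ENNReal.ofReal (1 - M i j) • Measure.dirac (j, false))

theorem isProbabilityMeasure_comparisonLaw {n : ℕ} (hn : 2 ≤ n) {M : Matrix (Fin n) (Fin n) ℝ}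
    (hM : M ∈ comparisonClass n 0) (i : Fin n) : IsProbabilityMeasure (comparisonLaw M i) := by
  constructor
  have hn' : (0 : ℝ) < (n : ℝ) - 1 := by
    have : (2 : ℝ) ≤ n := by exact_mod_cast hn
    linarith
  have h1 : ∀ j, ENNReal.ofReal (M i j) + ENNReal.ofReal (1 - M i j) = 1 := by
    intro j
    rw [← ENNReal.ofReal_add (hM i j).1.le (by linarith [(hM i j).2.1])]
    simp
  have h2 : ((n - 1 : ℕ) : ENNReal) = ENNReal.ofReal ((n : ℝ) - 1) := by
    rw [← ENNReal.ofReal_natCast, Nat.cast_sub (by omega)]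
    simp
  simp only [comparisonLaw, Measure.coe_finsetSum, Finset.sum_apply, Measure.smul_apply,
    Measure.add_apply, measure_univ, smul_eq_mul, mul_one, h1, Finset.sum_const, nsmul_eq_mul,
    Finset.card_erase_of_mem (Finset.mem_univ i), Finset.card_univ, Fintype.card_fin, h2]
  rw [← ENNReal.ofReal_mul hn'.le, mul_one_div_cancel hn'.ne', ENNReal.ofReal_one]

/-- The outcomes of all comparisons: `ω (i, u)` is the opponent and the result when item `i` is
compared for the `(u+1)`-st time. -/
abbrev Outcomes (n : ℕ) : Type := Fin n × ℕ → Fin n × Bool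

/-- All comparisons are independent, and each comparison of `i` has the law `comparisonLaw M i`. -/
def outcomesLaw {n : ℕ} (M : Matrix (Fin n) (Fin n) ℝ) : Measure (Outcomes n) :=
  Measure.infinitePi fun p : Fin n × ℕ => comparisonLaw M p.1

/-- The indicator that item `i` wins its `(u+1)`-st comparison. -/
def winIndicator {n : ℕ} (ω : Outcomes n) (i : Fin n) (u : ℕ) : ℝ :=
  if (ω (i, u)).2 = true then 1 else 0

/-! ### Confidence radii -/

/-- The confidence function used for `δ < 0.0005`. -/
def betaSmall (u : ℕ) (δ' : ℝ) : ℝ :=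
  Real.log (1 / δ') + 0.75 * Real.log (Real.log (1 / δ')) +
    1.5 * Real.log (1 + Real.log ((u : ℝ) / 2))

/-- The confidence function that can be used for every `δ < 1`. -/
def betaAll (u : ℕ) (δ' : ℝ) : ℝ :=
  2 * Real.log (125 * Real.log (1.12 * (u : ℝ)) / δ')

/-- The confidence radius `α(u)` after `u` comparisons of an item. -/
def alpha (β : ℕ → ℝ → ℝ) (n : ℕ) (δ : ℝ) (u : ℕ) : ℝ :=
  Real.sqrt (β u (δ / n) / (2 * u))

/-! ### The algorithm -/

/-- What the algorithm stores: for each item the number of comparisons made with it, and the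
current estimate of its score. -/
structure State (n : ℕ) where
  count : Fin n → ℕ
  est : Fin n → ℝ

/-- What the algorithm computes in a round: the permutation `(·)` and four items. -/
structure Selection (n : ℕ) where
  σ : Equiv.Perm (Fin n)
  d₁ : Fin n
  d₂ : Fin n
  b₁ : Fin n
  b₂ : Fin n

variable {n : ℕ}

/-- `x` is a minimizer of `f` over the set `S`. -/
def IsArgMin (f : Fin n → ℝ) (S : Finset (Fin n)) (x : Fin n) : Prop :=
  x ∈ S ∧ ∀ y ∈ S, f x ≤ f y

/-- `x` is a maximizer of `f` over the set `S`. -/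
def IsArgMax (f : Fin n → ℝ) (S : Finset (Fin n)) (x : Fin n) : Prop :=
  x ∈ S ∧ ∀ y ∈ S, f y ≤ f x

/-- The selections that the algorithm may make in state `s`, when its confidence radii are given
by `α`; they differ only in how ties are broken. -/
def IsSelection (α : ℕ → ℝ) (k h : ℕ) (s : State n) (c : Selection n) : Prop :=
  IsSorting s.est c.σ ∧
  IsArgMin (fun i => s.est i - α (s.count i)) (ranked c.σ 1 (k - h)) c.d₁ ∧
  IsArgMax (fun i => s.est i + α (s.count i)) (ranked c.σ (k + 1 + h) n) c.d₂ ∧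
  IsArgMax (fun i => α (s.count i)) (insert c.d₁ (ranked c.σ (k - h + 1) k)) c.b₁ ∧
  IsArgMax (fun i => α (s.count i)) (insert c.d₂ (ranked c.σ (k + 1) (k + h))) c.b₂

/-- A version of the algorithm: a rule which makes an admissible selection in every round `t` and
every state, that is, which breaks the ties. -/
structure Rule (n k h : ℕ) (α : ℕ → ℝ) where
  select : ℕ → State n → Selection n
  isSelection : ∀ t s, IsSelection α k h s (select t s)

/-- The state after the initialization, in which every item is compared once. -/
def initState (ω : Outcomes n) : State n where
  count := fun _ => 1
  est := fun i => winIndicator ω i 0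

/-- Compare item `i` once more and update its counter and the estimate of its score. -/
def State.compare (s : State n) (ω : Outcomes n) (i : Fin n) : State n where
  count := Function.update s.count i (s.count i + 1)
  est := Function.update s.est i
    ((s.count i : ℝ) / (s.count i + 1) * s.est i
      + 1 / (s.count i + 1) * winIndicator ω i (s.count i))

namespace Rule

variable {k h : ℕ} {α : ℕ → ℝ} (R : Rule n k h α)

/-- The state after the initialization and `t` rounds, were the algorithm not to stop. -/
def state (ω : Outcomes n) : ℕ → State n
  | 0 => initState ω
  | t + 1 =>
    ((state ω t).compare ω (R.select t (state ω t)).b₁).compare ω (R.select t (state ω t)).b₂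

/-- The selection made on the basis of the state after `t` rounds. -/
def selection (ω : Outcomes n) (t : ℕ) : Selection n := R.select t (R.state ω t)

/-- The termination condition, evaluated after `t` rounds, with the ordering and the indices of the
current state. It never holds for `t = 0`, where the estimates are `0` or `1` and `α 1 > 1 / 2`, so
that it makes no difference whether the loop is entered unconditionally the first time. -/
def Terminated (ω : Outcomes n) (t : ℕ) : Prop :=
  (R.state ω t).est (R.selection ω t).d₂ + α ((R.state ω t).count (R.selection ω t).d₂) ≤
    (R.state ω t).est (R.selection ω t).d₁ - α ((R.state ω t).count (R.selection ω t).d₁)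

/-- The algorithm stops after exactly `t` rounds. -/
def StopsAt (ω : Outcomes n) (t : ℕ) : Prop :=
  R.Terminated ω t ∧ ∀ t' < t, ¬ R.Terminated ω t'

/-- The number of comparisons made in the initialization and the first `t` rounds. -/
def comparisons (ω : Outcomes n) (t : ℕ) : ℕ := ∑ i, (R.state ω t).count i

/-- The ranking which is returned after `t` rounds is `h`-Hamming-accurate. -/
def AccurateAt (π : Equiv.Perm (Fin n)) (ω : Outcomes n) (t : ℕ) : Prop :=
  HammingAccurate k h π (ranked (R.selection ω t).σ 1 k) (ranked (R.selection ω t).σ (k + 1) n)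

end Rule

/-! ### The bound on the number of comparisons -/

/-- The gap `Δ_{r,s} = τ_{π(r)} - τ_{π(s)}` (ranks given as elements of `Fin n`). -/
def gap (M : Matrix (Fin n) (Fin n) ℝ) (π : Equiv.Perm (Fin n)) (r s : Fin n) : ℝ :=
  score M (π r) - score M (π s)

/-- `Δ⁻²` with its doubly logarithmic factor. -/
def gapCost (Δ : ℝ) : ℝ := Real.log (2 * Real.log (2 / Δ)) / Δ ^ 2

/-- `log (n / δ)` times the sum of the costs of the gaps `Δ_{r,k+1+h}` over the ranks `r ≤ k - h`,
of the gaps `Δ_{k-h,r}` over the ranks `r ≥ k + 1 + h`, and of `2h` times the cost of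
`Δ_{k-h,k+1+h}`. The parameters `top` and `bot` stand for the ranks `k - h` and `k + 1 + h`. -/
def complexity (M : Matrix (Fin n) (Fin n) ℝ) (π : Equiv.Perm (Fin n)) (h : ℕ) (δ : ℝ)
    (top bot : Fin n) : ℝ :=
  Real.log (n / δ) *
    (∑ r ∈ Finset.univ.filter (fun r => r ≤ top), gapCost (gap M π r bot) +
      ∑ r ∈ Finset.univ.filter (fun r => bot ≤ r), gapCost (gap M π top r) +
      2 * h * gapCost (gap M π top bot))

end HammingLUCB

end

/-!
All three claims hold on one event of probability at least `1 - δ` (`Concentrated`): at all times,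
the estimates of the scores of the `k` best items are not too low by more than the radius `α`,
those of the other items are not too high by as much as `α`, and no estimate is off by more than
`2α`. That the bound with the constant `1` is needed on one side only matters for `betaSmall`: the
probability of a one-sided violation is bounded by `0.95 δ / n`, which leaves no room for a second
side.

*Accuracy.* If more than `h` items of the returned top set were wrong, then one of the first
`k - h` estimated items is not among the `k` best, and one of the last `n - k - h` is. The
termination condition separates their confidence bounds in the wrong direction, which contradicts
the one-sided bounds (`Rule.accurateAt_of_terminated`).

*Number of comparisons.* Before termination, the estimates of `d₁`, `d₂` and the `2h` items in the
middle lie in a window of width `2a`, where `a` is the largest of their radii and belongs to `b₁` or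
`b₂`. By counting, one of the items of rank at least `k + 1 + h` is either one of these or is
estimated to be among the first `k - h` (`exists_mem_forall_le_add`); in both cases the scores of
all items in the window exceed the score of rank `k + 1 + h` by at most `9a`. Together with the
mirror image of this, the gap of the item with radius `a` is at most `18a` (`exists_itemGap_le`).
So each round compares an item which has not been compared often yet, and the number of rounds is
at most the sum of the sample sizes that make the radii smaller than the gaps
(`Rule.exists_stopsAt`, `count_le_of_gap_le`).

*Probability.* By Hoeffding's lemma the centred wins of an item are sub-Gaussian, and Ville's
inequality for the exponential supermartingales bounds the probability that their sum ever crosses a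
line (`measure_exists_line_le`). The times are cut into slices of ratio `exp l`, and on each slice
the boundary `u α(u)` is replaced by a line. This multiplies the exponents by no less than
`1 - l² / 16` (`measure_exists_curve_le`). With `l = √(8 / log (n / δ))` for `betaSmall` the sum
over the slices is below `0.95 δ / n`. Doubling the radius quadruples the exponents, so the bounds with
`2α` cost at most another `0.05 δ / n`.
-/

noncomputable section

namespace HammingLUCB

section Probability

open ProbabilityTheory ENNReal

/-! ### Ville's inequality -/

variable {Ω : Type*}

/-- The partial products of `W`, frozen as soon as they reach the level `c`. -/
def stoppedProd (W : ℕ → Ω → ℝ≥0∞) (c : ℝ≥0∞) : ℕ → Ω → ℝ≥0∞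
  | 0, _ => 1
  | N + 1, ω => if c ≤ stoppedProd W c N ω then stoppedProd W c N ω
      else stoppedProd W c N ω * W N ω

theorem stoppedProd_eq_or_le (W : ℕ → Ω → ℝ≥0∞) (c : ℝ≥0∞) (N : ℕ) (ω : Ω) :
    stoppedProd W c N ω = ∏ v ∈ Finset.range N, W v ω ∨ c ≤ stoppedProd W c N ω := by
  induction N with
  | zero => left; simp [stoppedProd]
  | succ N ih =>
    by_cases h : c ≤ stoppedProd W c N ω
    · right; simp [stoppedProd, h]
    · left
      rw [stoppedProd, if_neg h, ih.resolve_right h, Finset.prod_range_succ]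

theorem le_stoppedProd {W : ℕ → Ω → ℝ≥0∞} {c : ℝ≥0∞} {m N : ℕ} (hmN : m ≤ N) {ω : Ω}
    (h : c ≤ ∏ v ∈ Finset.range m, W v ω) : c ≤ stoppedProd W c N ω := by
  induction N, hmN using Nat.le_induction with
  | base =>
    rcases stoppedProd_eq_or_le W c m ω with h' | h'
    · rwa [h']
    · exact h'
  | succ N _ ih => rw [stoppedProd, if_pos ih]; exact ih

/-- The σ-algebra generated by `W 0, …, W (N - 1)`. -/
@[reducible] def past (W : ℕ → Ω → ℝ≥0∞) (N : ℕ) : MeasurableSpace Ω :=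
  ⨆ v ∈ Set.Iio N, MeasurableSpace.comap (W v) inferInstance

theorem measurable_stoppedProd {W : ℕ → Ω → ℝ≥0∞} (c : ℝ≥0∞) (N : ℕ) :
    Measurable[past W N] (stoppedProd W c N) := by
  induction N with
  | zero => exact @measurable_const _ _ _ (_) 1
  | succ N ih =>
    have h1 : Measurable[past W (N + 1)] (stoppedProd W c N) :=
      ih.mono (biSup_mono fun v hv => lt_trans hv (Nat.lt_succ_self N)) le_rfl
    have h2 : Measurable[past W (N + 1)] (W N) :=
      (comap_measurable (W N)).mono
        (le_biSup (fun v => MeasurableSpace.comap (W v) inferInstance)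
          (Set.mem_Iio.2 (Nat.lt_succ_self N))) le_rfl
    exact Measurable.ite (h1 measurableSet_Ici) h1 (h1.mul h2)

variable [mΩ : MeasurableSpace Ω] {μ : Measure Ω}

theorem lintegral_stoppedProd_le [IsProbabilityMeasure μ] {W : ℕ → Ω → ℝ≥0∞}
    (hW : ∀ v, Measurable (W v)) (hind : iIndepFun W μ) (h1 : ∀ v, ∫⁻ ω, W v ω ∂μ ≤ 1)
    (c : ℝ≥0∞) (N : ℕ) : ∫⁻ ω, stoppedProd W c N ω ∂μ ≤ 1 := by
  induction N with
  | zero => simp [stoppedProd]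
  | succ N ih =>
    have hle : past W N ≤ mΩ := iSup₂_le fun v _ => (hW v).comap_le
    have hV := measurable_stoppedProd (W := W) c N
    have hA : MeasurableSet[past W N] {ω | c ≤ stoppedProd W c N ω} := hV measurableSet_Ici
    have hindep : Indep (past W N) (MeasurableSpace.comap (W N) inferInstance) (_mΩ := mΩ) μ := by
      have := indep_iSup_of_disjoint (μ := μ)
        (m := fun v => MeasurableSpace.comap (W v) inferInstance)
        (fun v => (hW v).comap_le) hind (S := Set.Iio N) (T := {N}) (by simp)
      simpa [past] using this
    have hprod : ∫⁻ ω, ({ω | c ≤ stoppedProd W c N ω}ᶜ).indicator (stoppedProd W c N) ω * W N ω ∂μ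
        = (∫⁻ ω, ({ω | c ≤ stoppedProd W c N ω}ᶜ).indicator (stoppedProd W c N) ω ∂μ) *
          ∫⁻ ω, W N ω ∂μ :=
      lintegral_mul_eq_lintegral_mul_lintegral_of_independent_measurableSpace hle
        (hW N).comap_le hindep (hV.indicator hA.compl) (comap_measurable (W N))
    have hsplit : ∀ ω, stoppedProd W c (N + 1) ω =
        ({ω | c ≤ stoppedProd W c N ω}).indicator (stoppedProd W c N) ω +
        ({ω | c ≤ stoppedProd W c N ω}ᶜ).indicator (stoppedProd W c N) ω * W N ω := by
      intro ω
      by_cases h : c ≤ stoppedProd W c N ω <;> simp [stoppedProd, h]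
    have hVm : Measurable (stoppedProd W c N) := hV.mono hle le_rfl
    calc ∫⁻ ω, stoppedProd W c (N + 1) ω ∂μ
        = ∫⁻ ω, ({ω | c ≤ stoppedProd W c N ω}).indicator (stoppedProd W c N) ω ∂μ +
          (∫⁻ ω, ({ω | c ≤ stoppedProd W c N ω}ᶜ).indicator (stoppedProd W c N) ω ∂μ) *
          ∫⁻ ω, W N ω ∂μ := by
          rw [lintegral_congr hsplit, lintegral_add_left (hVm.indicator (hle _ hA)), hprod]
      _ ≤ ∫⁻ ω, ({ω | c ≤ stoppedProd W c N ω}).indicator (stoppedProd W c N) ω ∂μ +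
          ∫⁻ ω, ({ω | c ≤ stoppedProd W c N ω}ᶜ).indicator (stoppedProd W c N) ω ∂μ := by
          gcongr
          exact mul_le_of_le_one_right' (h1 N)
      _ = ∫⁻ ω, stoppedProd W c N ω ∂μ := by
          rw [← lintegral_add_left (hVm.indicator (hle _ hA))]
          refine lintegral_congr fun ω => ?_
          exact congrFun (Set.indicator_self_add_compl {ω | c ≤ stoppedProd W c N ω} _) ω
      _ ≤ 1 := ih

/-- **Ville's inequality** for a product of independent nonnegative factors of mean at most one:
the partial products ever reach the level `c` with probability at most `1 / c`. -/
theorem measure_exists_le_prod_le [IsProbabilityMeasure μ] {W : ℕ → Ω → ℝ≥0∞}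
    (hW : ∀ v, Measurable (W v)) (hind : iIndepFun W μ) (h1 : ∀ v, ∫⁻ ω, W v ω ∂μ ≤ 1)
    {c : ℝ≥0∞} (hc0 : c ≠ 0) (hc : c ≠ ⊤) :
    μ {ω | ∃ N, c ≤ ∏ v ∈ Finset.range N, W v ω} ≤ c⁻¹ := by
  have hsub : {ω | ∃ N, c ≤ ∏ v ∈ Finset.range N, W v ω} ⊆
      ⋃ N, {ω | c ≤ stoppedProd W c N ω} := by
    rintro ω ⟨N, hN⟩
    exact Set.mem_iUnion.2 ⟨N, le_stoppedProd le_rfl hN⟩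
  have hmono : Monotone fun N => {ω | c ≤ stoppedProd W c N ω} := by
    refine monotone_nat_of_le_succ fun N ω (hω : c ≤ _) => ?_
    show c ≤ stoppedProd W c (N + 1) ω
    rw [stoppedProd, if_pos hω]; exact hω
  refine (measure_mono hsub).trans ?_
  rw [hmono.measure_iUnion]
  refine iSup_le fun N => ?_
  have hVm : Measurable (stoppedProd W c N) :=
    (measurable_stoppedProd c N).mono (iSup₂_le fun v _ => (hW v).comap_le) le_rfl
  calc μ {ω | c ≤ stoppedProd W c N ω} ≤ (∫⁻ ω, stoppedProd W c N ω ∂μ) / c :=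
        meas_ge_le_lintegral_div hVm.aemeasurable hc0 hc
    _ ≤ 1 / c := by gcongr; exact lintegral_stoppedProd_le hW hind h1 c N
    _ = c⁻¹ := one_div c

/-- A sub-Gaussian random walk ever crosses a line with exponentially small probability. -/
theorem measure_exists_line_le [IsProbabilityMeasure μ] {X : ℕ → Ω → ℝ}
    (hX : ∀ v, Measurable (X v)) (hind : iIndepFun X μ) {c : NNReal}
    (hsub : ∀ v, HasSubgaussianMGF (X v) c μ) (l b : ℝ) :
    μ {ω | ∃ N : ℕ, b ≤ l * ∑ v ∈ Finset.range N, X v ω - N * (c * l ^ 2 / 2)} ≤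
      ENNReal.ofReal (Real.exp (-b)) := by
  set W : ℕ → Ω → ℝ≥0∞ := fun v ω => ENNReal.ofReal (Real.exp (l * X v ω - c * l ^ 2 / 2))
    with hWdef
  have hg : Measurable fun x : ℝ => ENNReal.ofReal (Real.exp (l * x - c * l ^ 2 / 2)) := by
    fun_prop
  have hW : ∀ v, Measurable (W v) := fun v => hg.comp (hX v)
  have hWind : iIndepFun W μ := hind.comp
    (fun _ x => ENNReal.ofReal (Real.exp (l * x - c * l ^ 2 / 2)))
    fun _ => hg
  have h1 : ∀ v, ∫⁻ ω, W v ω ∂μ ≤ 1 := by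
    intro v
    have hint : Integrable (fun ω => Real.exp (l * X v ω - c * l ^ 2 / 2)) μ := by
      simp only [Real.exp_sub]
      exact ((hsub v).integrable_exp_mul l).div_const _
    rw [← ofReal_integral_eq_lintegral_ofReal hint
      (Filter.Eventually.of_forall fun ω => (Real.exp_pos _).le), ← ENNReal.ofReal_one]
    refine ENNReal.ofReal_le_ofReal ?_
    simp only [Real.exp_sub]
    rw [integral_div, div_le_one (Real.exp_pos _)]
    exact (hsub v).mgf_le l
  have h := measure_exists_le_prod_le hW hWind h1
    (c := ENNReal.ofReal (Real.exp b)) (by simpa using Real.exp_pos b) ENNReal.ofReal_ne_top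
  rw [← ENNReal.ofReal_inv_of_pos (Real.exp_pos b), ← Real.exp_neg] at h
  refine (measure_mono ?_).trans h
  rintro ω ⟨N, hN⟩
  refine ⟨N, ?_⟩
  rw [hWdef, ← ENNReal.ofReal_prod_of_nonneg (fun _ _ => (Real.exp_pos _).le), ← Real.exp_sum,
    Finset.sum_sub_distrib, ← Finset.mul_sum]
  refine ENNReal.ofReal_le_ofReal (Real.exp_le_exp.2 ?_)
  simpa using hN

/-! ### Curved boundaries -/

/-- The loss in the exponent when one line has to serve a whole slice of times with ratio
`exp l`. -/
theorem one_sub_sq_div_le {l z : ℝ} (h1 : 1 / (1 + Real.exp (l / 2)) ≤ z)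
    (h2 : z ≤ Real.exp (l / 2) / (1 + Real.exp (l / 2))) :
    1 - l ^ 2 / 16 ≤ 4 * (z * (1 - z)) := by
  set q := Real.exp (l / 2) with hq
  have hq0 : 0 < q := Real.exp_pos _
  have hq1 : (0 : ℝ) < 1 + q := by positivity
  have hmul : 4 * q / (1 + q) ^ 2 ≤ 4 * (z * (1 - z)) := by
    have e : q / (1 + q) ^ 2 = 1 / (1 + q) * (q / (1 + q)) := by field_simp
    have e2 : 1 / (1 + q) + q / (1 + q) = 1 := by field_simp
    have := mul_nonneg (sub_nonneg.2 h1) (sub_nonneg.2 h2)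
    rw [mul_div_assoc, e]
    nlinarith
  refine le_trans ?_ hmul
  have hcosh : (1 + q) ^ 2 = 4 * q * Real.cosh (l / 4) ^ 2 := by
    have e1 : q = Real.exp (l / 4) * Real.exp (l / 4) := by
      rw [hq, ← Real.exp_add]; ring_nf
    have e2 : Real.exp (l / 4) * Real.exp (-(l / 4)) = 1 := by
      rw [← Real.exp_add]; simp
    rw [Real.cosh_eq]
    have : 4 * q * ((Real.exp (l / 4) + Real.exp (-(l / 4))) / 2) ^ 2
        = (Real.exp (l / 4) * (Real.exp (l / 4) + Real.exp (-(l / 4)))) ^ 2 := by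
      rw [e1]; ring
    rw [this, mul_add, e2, ← e1, add_comm]
  rw [hcosh, div_mul_cancel_left₀ (by positivity)]
  have hle : Real.cosh (l / 4) ^ 2 ≤ Real.exp (l ^ 2 / 16) := by
    calc Real.cosh (l / 4) ^ 2 ≤ Real.exp ((l / 4) ^ 2 / 2) ^ 2 := by
          have := Real.cosh_le_exp_half_sq (l / 4)
          have := Real.cosh_pos (l / 4)
          gcongr
      _ = _ := by rw [← Real.exp_nat_mul]; congr 1; push_cast; ring
  calc 1 - l ^ 2 / 16 ≤ Real.exp (-(l ^ 2 / 16)) := by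
        linarith [Real.add_one_le_exp (-(l ^ 2 / 16))]
    _ = (Real.exp (l ^ 2 / 16))⁻¹ := Real.exp_neg _
    _ ≤ _ := by
        have := Real.cosh_pos (l / 4)
        gcongr

/-- **Peeling.** The times `u ≥ t₀` are cut into slices of ratio `exp l`; the curve
`√(u b / 2)` is replaced on each slice by a line. -/
theorem measure_exists_curve_le [IsProbabilityMeasure μ] {X : ℕ → Ω → ℝ}
    (hX : ∀ v, Measurable (X v)) (hind : iIndepFun X μ)
    (hsub : ∀ v, HasSubgaussianMGF (X v) (1 / 4) μ) {l t₀ : ℝ} (hl : 0 < l) (ht₀ : 0 < t₀)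
    {b : ℕ → ℝ} (hb : ∀ j, 0 ≤ b j) {x : ℕ → ℝ}
    (hx : ∀ (u j : ℕ), t₀ ≤ u → j * l ≤ Real.log (u / t₀) → √(u * b j / 2) ≤ x u) :
    μ {ω | ∃ u : ℕ, t₀ ≤ u ∧ x u ≤ ∑ v ∈ Finset.range u, X v ω} ≤
      ∑' j, ENNReal.ofReal (Real.exp (-((1 - l ^ 2 / 16) * b j))) := by
  set q := Real.exp (l / 2) with hq
  have hq0 : 0 < q := Real.exp_pos _
  have hq1 : (0 : ℝ) < 1 + q := by positivity
  -- the slope for which the bound is the same at both ends of the slice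
  set lam : ℕ → ℝ := fun j => 8 * √(b j / 2) / ((1 + q) * √(t₀ * Real.exp (j * l))) with hlam
  have hcover : {ω | ∃ u : ℕ, t₀ ≤ u ∧ x u ≤ ∑ v ∈ Finset.range u, X v ω} ⊆
      ⋃ j, {ω | ∃ N : ℕ, (1 - l ^ 2 / 16) * b j ≤
        lam j * ∑ v ∈ Finset.range N, X v ω - N * (((1 / 4 : NNReal) : ℝ) * lam j ^ 2 / 2)} := by
    rintro ω ⟨u, hu, hxu⟩
    have hu0 : (0 : ℝ) < u := ht₀.trans_le hu
    have hlog : 0 ≤ Real.log (u / t₀) := Real.log_nonneg ((one_le_div ht₀).2 hu)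
    set j := ⌊Real.log (u / t₀) / l⌋₊ with hj
    have hj1 : j * l ≤ Real.log (u / t₀) :=
      (le_div_iff₀ hl).1 (Nat.floor_le (div_nonneg hlog hl.le))
    have hj2 : Real.log (u / t₀) < (j + 1) * l := (div_lt_iff₀ hl).1 (Nat.lt_floor_add_one _)
    refine Set.mem_iUnion.2 ⟨j, u, ?_⟩
    have hE : Real.exp (Real.log (u / t₀)) = u / t₀ := Real.exp_log (by positivity)
    have hs1 : t₀ * Real.exp (j * l) ≤ u := by
      have := Real.exp_le_exp.2 hj1
      rw [hE, le_div_iff₀ ht₀] at this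
      linarith
    have hs2 : (u : ℝ) ≤ q ^ 2 * (t₀ * Real.exp (j * l)) := by
      have := Real.exp_le_exp.2 hj2.le
      rw [hE, div_le_iff₀ ht₀] at this
      refine this.trans (le_of_eq ?_)
      rw [hq, ← Real.exp_nat_mul, mul_left_comm, ← Real.exp_add, mul_comm]
      congr 2; push_cast; ring
    set m := √(b j / 2) with hm
    set s := √(u : ℝ) with hs
    set a := √(t₀ * Real.exp (j * l)) with ha
    have ha0 : 0 < a := Real.sqrt_pos.2 (by positivity)
    have hm2 : m ^ 2 = b j / 2 := Real.sq_sqrt (by linarith [hb j])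
    have hss : s ^ 2 = u := Real.sq_sqrt hu0.le
    have has : a ≤ s := Real.sqrt_le_sqrt hs1
    have hsa : s ≤ q * a := by
      rw [hs, ha, ← Real.sqrt_sq hq0.le, ← Real.sqrt_mul (by positivity)]
      exact Real.sqrt_le_sqrt hs2
    set z := s / ((1 + q) * a) with hz
    have hz1 : 1 / (1 + q) ≤ z := by
      rw [hz, div_le_div_iff₀ hq1 (by positivity)]
      nlinarith
    have hz2 : z ≤ q / (1 + q) := by
      rw [hz, div_le_div_iff₀ (by positivity) hq1]
      nlinarith
    have hmain := one_sub_sq_div_le hz1 hz2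
    have hsm : s * m ≤ ∑ v ∈ Finset.range u, X v ω := by
      have : s * m = √(u * b j / 2) := by
        rw [hs, hm, ← Real.sqrt_mul hu0.le, mul_div_assoc]
      rw [this]
      exact (hx u j hu hj1).trans hxu
    have hl0 : 0 ≤ lam j := by
      simp only [hlam]; positivity
    have hls : lam j * s = 8 * m * z := by
      simp only [hlam, hz]; rw [← hm, ← ha]; ring
    calc (1 - l ^ 2 / 16) * b j ≤ 4 * (z * (1 - z)) * b j := by gcongr; exact hb j
      _ = 8 * m ^ 2 * (z - z ^ 2) := by rw [hm2]; ring
      _ = lam j * s * m - (lam j * s) ^ 2 / 8 := by rw [hls]; ring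
      _ = lam j * (s * m) - u * (1 / 4 * lam j ^ 2 / 2) := by rw [← hss]; ring
      _ ≤ _ := by
        push_cast
        gcongr
  refine (measure_mono hcover).trans ((measure_iUnion_le _).trans ?_)
  exact ENNReal.tsum_le_tsum fun j => measure_exists_line_le hX hind hsub (lam j) _

/-- Comparison of `∑ w ^ (-7/5)` with the integral, by telescoping `w ^ (-2/5)`. -/
theorem sum_rpow_le {y l : ℝ} (hy : 0 < y) (hl : 0 < l) (J : ℕ) :
    ∑ j ∈ Finset.range J, (y + (j + 1) * l) ^ (-(7 / 5) : ℝ) ≤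
      5 / 2 / l * (y ^ (-(2 / 5) : ℝ) - (y + J * l) ^ (-(2 / 5) : ℝ)) := by
  induction J with
  | zero => simp
  | succ J ih =>
    rw [Finset.sum_range_succ]
    set w := y + J * l with hw
    have hw0 : 0 < w := by positivity
    have hz : y + ((J : ℝ) + 1) * l = w + l := by rw [hw]; ring
    push_cast
    rw [hz]
    have hz0 : 0 < w + l := by positivity
    -- Bernoulli's inequality, in place of the mean value theorem
    have key : (2 / 5) * l * (w + l) ^ (-(7 / 5) : ℝ) ≤
        w ^ (-(2 / 5) : ℝ) - (w + l) ^ (-(2 / 5) : ℝ) := by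
      set r := l / (w + l) with hr
      have hr0 : 0 ≤ r := by positivity
      have hr1 : r < 1 := by rw [hr, div_lt_one hz0]; linarith
      have hwr : w = (w + l) * (1 - r) := by rw [hr]; field_simp; ring
      have hb : (1 - r) ^ (2 / 5 : ℝ) ≤ 1 - 2 / 5 * r := by
        have := rpow_one_add_le_one_add_mul_self (s := -r) (by linarith) (p := 2 / 5)
          (by norm_num) (by norm_num)
        rw [← sub_eq_add_neg] at this
        linarith
      have hb' : 1 + 2 / 5 * r ≤ (1 - r) ^ (-(2 / 5) : ℝ) := by
        rw [Real.rpow_neg (by linarith)]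
        have hpos : 0 < (1 - r) ^ (2 / 5 : ℝ) := Real.rpow_pos_of_pos (by linarith) _
        rw [le_inv_comm₀ (by positivity) hpos]
        refine hb.trans ?_
        rw [le_inv_comm₀ (by linarith) (by positivity), inv_eq_one_div,
          le_div_iff₀ (by linarith)]
        nlinarith
      have e1 : w ^ (-(2 / 5) : ℝ) = (w + l) ^ (-(2 / 5) : ℝ) * (1 - r) ^ (-(2 / 5) : ℝ) := by
        conv_lhs => rw [hwr]
        rw [Real.mul_rpow hz0.le (by linarith)]
      have e2 : l * (w + l) ^ (-(7 / 5) : ℝ) = r * (w + l) ^ (-(2 / 5) : ℝ) := by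
        have : (-(7 / 5) : ℝ) = -(2 / 5) - 1 := by norm_num
        rw [this, Real.rpow_sub_one hz0.ne', hr]
        ring
      have hp : 0 < (w + l) ^ (-(2 / 5) : ℝ) := Real.rpow_pos_of_pos hz0 _
      rw [e1, mul_assoc, e2]
      nlinarith
    have : (w + l) ^ (-(7 / 5) : ℝ) ≤
        5 / 2 / l * (w ^ (-(2 / 5) : ℝ) - (w + l) ^ (-(2 / 5) : ℝ)) := by
      rw [div_mul_eq_mul_div, le_div_iff₀ hl]
      linarith
    calc _ ≤ 5 / 2 / l * (y ^ (-(2 / 5) : ℝ) - w ^ (-(2 / 5) : ℝ)) +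
          5 / 2 / l * (w ^ (-(2 / 5) : ℝ) - (w + l) ^ (-(2 / 5) : ℝ)) := add_le_add ih this
      _ = _ := by ring

theorem tsum_ofReal_rpow_le {y l A : ℝ} (hy : 0 < y) (hl : 0 < l) (hA : 0 ≤ A) {f : ℕ → ℝ}
    (hf : ∀ j : ℕ, f j ≤ A * (y + j * l) ^ (-(7 / 5) : ℝ)) :
    ∑' j, ENNReal.ofReal (f j) ≤
      ENNReal.ofReal (A * (y ^ (-(7 / 5) : ℝ) + 5 / 2 / l * y ^ (-(2 / 5) : ℝ))) := by
  rw [tsum_eq_zero_add' ENNReal.summable]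
  have hpos : ∀ r : ℝ, 0 ≤ y ^ r := fun r => Real.rpow_nonneg hy.le r
  rw [mul_add, ENNReal.ofReal_add (mul_nonneg hA (hpos _)) (by have := hpos (-(2 / 5)); positivity)]
  refine add_le_add (ENNReal.ofReal_le_ofReal (by simpa using hf 0)) ?_
  refine ENNReal.tsum_le_of_sum_range_le fun J => ?_
  have hterm : ∀ j : ℕ, 0 ≤ A * (y + (j + 1) * l) ^ (-(7 / 5) : ℝ) := fun j =>
    mul_nonneg hA (Real.rpow_nonneg (by positivity) _)
  calc ∑ j ∈ Finset.range J, ENNReal.ofReal (f (j + 1))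
      ≤ ∑ j ∈ Finset.range J, ENNReal.ofReal (A * (y + (j + 1) * l) ^ (-(7 / 5) : ℝ)) :=
        Finset.sum_le_sum fun j _ => ENNReal.ofReal_le_ofReal (by simpa using hf (j + 1))
    _ = ENNReal.ofReal (A * ∑ j ∈ Finset.range J, (y + (j + 1) * l) ^ (-(7 / 5) : ℝ)) := by
        rw [Finset.mul_sum, ENNReal.ofReal_sum_of_nonneg fun j _ => hterm j]
    _ ≤ _ := by
        refine ENNReal.ofReal_le_ofReal (mul_le_mul_of_nonneg_left ?_ hA)
        refine (sum_rpow_le hy hl J).trans ?_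
        refine mul_le_mul_of_nonneg_left ?_ (by positivity)
        have : 0 ≤ (y + J * l) ^ (-(2 / 5) : ℝ) := Real.rpow_nonneg (by positivity) _
        linarith

/-- The peeling bound in closed form. Doubling the curve multiplies the exponents by four, which
makes the probability smaller by a factor `19 < exp 3`. -/
theorem measure_exists_curve_le_of_rpow [IsProbabilityMeasure μ] {X : ℕ → Ω → ℝ}
    (hX : ∀ v, Measurable (X v)) (hind : iIndepFun X μ)
    (hsub : ∀ v, HasSubgaussianMGF (X v) (1 / 4) μ) {l t₀ y A : ℝ} (hl : 0 < l) (ht₀ : 0 < t₀)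
    (hy : 0 < y) (hA : 0 ≤ A) {b : ℕ → ℝ} (hb : ∀ j, 0 ≤ b j) {x : ℕ → ℝ}
    (hx : ∀ (u j : ℕ), t₀ ≤ u → j * l ≤ Real.log (u / t₀) → √(u * b j / 2) ≤ x u)
    (hbA : ∀ j : ℕ, Real.exp (-((1 - l ^ 2 / 16) * b j)) ≤ A * (y + j * l) ^ (-(7 / 5) : ℝ))
    (hb1 : ∀ j : ℕ, 1 ≤ (1 - l ^ 2 / 16) * b j) :
    μ {ω | ∃ u : ℕ, t₀ ≤ u ∧ x u ≤ ∑ v ∈ Finset.range u, X v ω} ≤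
        ENNReal.ofReal (A * (y ^ (-(7 / 5) : ℝ) + 5 / 2 / l * y ^ (-(2 / 5) : ℝ))) ∧
      μ {ω | ∃ u : ℕ, t₀ ≤ u ∧ 2 * x u ≤ ∑ v ∈ Finset.range u, X v ω} ≤
        ENNReal.ofReal (A / 19 * (y ^ (-(7 / 5) : ℝ) + 5 / 2 / l * y ^ (-(2 / 5) : ℝ))) := by
  constructor
  · exact (measure_exists_curve_le hX hind hsub hl ht₀ hb hx).trans
      (tsum_ofReal_rpow_le hy hl hA hbA)
  · refine (measure_exists_curve_le hX hind hsub hl ht₀ (b := fun j => 4 * b j)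
      (fun j => by have := hb j; positivity) (x := fun u => 2 * x u) ?_).trans
      (tsum_ofReal_rpow_le hy hl (by positivity) ?_)
    · intro u j hu hj
      have : (u : ℝ) * (4 * b j) / 2 = 2 ^ 2 * (u * b j / 2) := by ring
      rw [this, Real.sqrt_mul (by norm_num), Real.sqrt_sq (by norm_num)]
      linarith [hx u j hu hj]
    · intro j
      have h3 : Real.exp (-(3 * ((1 - l ^ 2 / 16) * b j))) ≤ 1 / 19 := by
        calc Real.exp (-(3 * ((1 - l ^ 2 / 16) * b j))) ≤ Real.exp (-3) :=
              Real.exp_le_exp.2 (by linarith [hb1 j])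
          _ ≤ 1 / 19 := by
              rw [Real.exp_neg, inv_eq_one_div]
              have h := Real.exp_one_gt_d9
              have e : Real.exp 3 = Real.exp 1 ^ 3 := by rw [← Real.exp_nat_mul]; norm_num
              have : (2.71 : ℝ) ^ 3 ≤ Real.exp 1 ^ 3 := by gcongr; linarith
              apply one_div_le_one_div_of_le (by norm_num)
              rw [e]; refine le_trans ?_ this; norm_num
      calc Real.exp (-((1 - l ^ 2 / 16) * (4 * b j)))
          = Real.exp (-((1 - l ^ 2 / 16) * b j)) * Real.exp (-(3 * ((1 - l ^ 2 / 16) * b j))) := by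
            rw [← Real.exp_add]; congr 1; ring
        _ ≤ (A * (y + j * l) ^ (-(7 / 5) : ℝ)) * (1 / 19) := by
            gcongr
            exact hbA j
        _ = _ := by ring

/-! ### The two confidence functions -/

/-- Here the exponent `2` of `log (1.12 u)` leaves room to spare, so that slices of fixed ratio and
crude numerical estimates do. -/
theorem measure_exists_betaAll_le [IsProbabilityMeasure μ] {X : ℕ → Ω → ℝ}
    (hX : ∀ v, Measurable (X v)) (hind : iIndepFun X μ)
    (hsub : ∀ v, HasSubgaussianMGF (X v) (1 / 4) μ) {d : ℝ} (hd0 : 0 < d) (hd1 : d < 1) :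
    μ {ω | ∃ u : ℕ, 1 ≤ u ∧ √(u * betaAll u d / 2) ≤ ∑ v ∈ Finset.range u, X v ω} ≤
        ENNReal.ofReal (0.95 * d) ∧
      μ {ω | ∃ u : ℕ, 1 ≤ u ∧ 2 * √(u * betaAll u d / 2) ≤ ∑ v ∈ Finset.range u, X v ω} ≤
        ENNReal.ofReal (0.05 * d) := by
  set y := Real.log 1.12 with hy
  have hy1 : 0.1 ≤ y := by
    have := Real.one_sub_inv_le_log_of_pos (x := 1.12) (by norm_num)
    rw [hy]; refine le_trans ?_ this; norm_num
  have hy0 : 0 < y := by linarith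
  -- for this width of the slices the exponent `2 (1 - l ^ 2 / 16)` is `7 / 5`
  set l := √(4.8 : ℝ) with hl
  have hl2 : l ^ 2 = 4.8 := Real.sq_sqrt (by norm_num)
  have hl0 : 2 ≤ l := by
    rw [hl]; exact Real.le_sqrt_of_sq_le (by norm_num)
  have hth : 1 - l ^ 2 / 16 = 0.7 := by rw [hl2]; norm_num
  set b : ℕ → ℝ := fun j => 2 * Real.log (125 * (y + j * l) / d) with hbdef
  have hz : ∀ j : ℕ, 12.5 ≤ 125 * (y + j * l) / d := by
    intro j
    have : (0 : ℝ) ≤ j * l := by positivity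
    rw [le_div_iff₀ hd0]; nlinarith
  have hb1 : ∀ j : ℕ, 1 ≤ Real.log (125 * (y + j * l) / d) := by
    intro j
    rw [Real.le_log_iff_exp_le (by linarith [hz j])]
    linarith [hz j, Real.exp_one_lt_d9]
  have hbA : ∀ j : ℕ, Real.exp (-((1 - l ^ 2 / 16) * b j)) ≤
      d / 125 * (y + j * l) ^ (-(7 / 5) : ℝ) := by
    intro j
    have hyj : 0 < y + j * l := by positivity
    have e : Real.exp (-((1 - l ^ 2 / 16) * b j)) =
        (125 * (y + j * l) / d) ^ (-(7 / 5) : ℝ) := by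
      rw [Real.rpow_def_of_pos (by linarith [hz j]), hth]
      congr 1; simp only [hbdef]; ring
    rw [e, mul_div_right_comm, Real.mul_rpow (by positivity) hyj.le]
    gcongr
    rw [Real.rpow_neg (by positivity), ← Real.inv_rpow (by positivity), inv_div]
    calc (d / 125) ^ (7 / 5 : ℝ) ≤ (d / 125) ^ (1 : ℝ) :=
          Real.rpow_le_rpow_of_exponent_ge (by positivity) (by linarith) (by norm_num)
      _ = d / 125 := Real.rpow_one _
  have hmain := measure_exists_curve_le_of_rpow hX hind hsub (l := l) (t₀ := 1) (y := y)
    (A := d / 125) (by linarith) one_pos hy0 (by positivity) (b := b)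
    (fun j => by have := hb1 j; simp only [hbdef]; linarith)
    (x := fun u => √(u * betaAll u d / 2)) ?_ hbA
    (fun j => by rw [hth]; have := hb1 j; simp only [hbdef]; linarith)
  · have h10 : y ^ (-(7 / 5) : ℝ) ≤ 100 ∧ y ^ (-(2 / 5) : ℝ) ≤ 10 := by
      have hgen : ∀ r : ℝ, 0 ≤ r → y ^ (-r) ≤ (10 : ℝ) ^ r := by
        intro r hr
        rw [Real.rpow_neg hy0.le, ← Real.inv_rpow hy0.le]
        refine Real.rpow_le_rpow (by positivity) ?_ hr
        rw [inv_le_comm₀ hy0 (by norm_num)]; norm_num at hy1 ⊢; exact hy1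
      constructor
      · calc y ^ (-(7 / 5) : ℝ) ≤ (10 : ℝ) ^ (7 / 5 : ℝ) := hgen _ (by norm_num)
          _ ≤ (10 : ℝ) ^ (2 : ℝ) := Real.rpow_le_rpow_of_exponent_le (by norm_num) (by norm_num)
          _ = 100 := by norm_num
      · calc y ^ (-(2 / 5) : ℝ) ≤ (10 : ℝ) ^ (2 / 5 : ℝ) := hgen _ (by norm_num)
          _ ≤ (10 : ℝ) ^ (1 : ℝ) := Real.rpow_le_rpow_of_exponent_le (by norm_num) (by norm_num)
          _ = 10 := by norm_num
    have hl' : 5 / 2 / l ≤ 5 / 4 := by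
      rw [div_le_iff₀ (by linarith)]; linarith
    have htot : y ^ (-(7 / 5) : ℝ) + 5 / 2 / l * y ^ (-(2 / 5) : ℝ) ≤ 112.5 := by
      have : 5 / 2 / l * y ^ (-(2 / 5) : ℝ) ≤ 5 / 4 * 10 :=
        mul_le_mul hl' h10.2 (Real.rpow_nonneg hy0.le _) (by norm_num)
      linarith [h10.1]
    have hset : ∀ c : ℝ, {ω | ∃ u : ℕ, 1 ≤ u ∧ c * √(u * betaAll u d / 2) ≤
        ∑ v ∈ Finset.range u, X v ω} = {ω | ∃ u : ℕ, (1 : ℝ) ≤ u ∧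
        c * √(u * betaAll u d / 2) ≤ ∑ v ∈ Finset.range u, X v ω} := by
      intro c; simp only [Nat.one_le_cast]
    have h1 := hset 1
    simp only [one_mul] at h1
    rw [h1, hset 2]
    refine ⟨hmain.1.trans (ENNReal.ofReal_le_ofReal ?_), hmain.2.trans
      (ENNReal.ofReal_le_ofReal ?_)⟩
    · nlinarith
    · nlinarith
  · intro u j hu hj
    have hu0 : (0 : ℝ) < u := by linarith
    have hyj : 0 < y + j * l := by positivity
    refine Real.sqrt_le_sqrt ?_
    have : b j ≤ betaAll u d := by
      simp only [hbdef, betaAll]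
      rw [Real.log_mul (by norm_num) hu0.ne', ← hy]
      rw [div_one] at hj
      gcongr
    gcongr

/-- There is little room in this bound. For small `d` it requires slices whose width shrinks like
`1 / √(log (1 / d))`. The times `u ≤ 4` are treated separately: there `alpha` exceeds `1`, and
increments below `1` cannot reach the boundary. -/
theorem measure_exists_betaSmall_le [IsProbabilityMeasure μ] {X : ℕ → Ω → ℝ}
    (hX : ∀ v, Measurable (X v)) (hind : iIndepFun X μ)
    (hsub : ∀ v, HasSubgaussianMGF (X v) (1 / 4) μ) (hlt : ∀ v ω, X v ω < 1)
    {d : ℝ} (hd0 : 0 < d) (hd1 : d < 1 / 4000) :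
    μ {ω | ∃ u : ℕ, 1 ≤ u ∧ √(u * betaSmall u d / 2) ≤ ∑ v ∈ Finset.range u, X v ω} ≤
        ENNReal.ofReal (0.95 * d) ∧
      μ {ω | ∃ u : ℕ, 1 ≤ u ∧ 2 * √(u * betaSmall u d / 2) ≤ ∑ v ∈ Finset.range u, X v ω} ≤
        ENNReal.ofReal (0.05 * d) := by
  set L := Real.log (1 / d) with hL
  have hL8 : 8 ≤ L := by
    rw [hL, Real.le_log_iff_exp_le (by positivity)]
    have h1 : Real.exp 8 = Real.exp 1 ^ 8 := by rw [← Real.exp_nat_mul]; norm_num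
    have h2 : Real.exp 1 ^ 8 ≤ 2.72 ^ 8 := by
      have := Real.exp_one_lt_d9
      gcongr; linarith
    have h3 : 4000 ≤ 1 / d := by rw [le_div_iff₀ hd0]; linarith
    rw [h1]; refine h2.trans (le_trans ?_ h3); norm_num
  have hL0 : 0 < L := by linarith
  have hlog8 : 2.07 ≤ Real.log 8 := by
    have : Real.log 8 = 3 * Real.log 2 := by
      rw [← Real.log_rpow (by norm_num)]; norm_num
    rw [this]; linarith [Real.log_two_gt_d9]
  have hlogL : Real.log 8 ≤ Real.log L := Real.log_le_log (by norm_num) hL8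
  set y := 1 + Real.log (5 / 2) with hy
  have hy1 : 1.89 ≤ y := by
    have h := Real.one_sub_inv_le_log_of_pos (x := 5 / 4) (by norm_num)
    have e : Real.log (5 / 2) = Real.log 2 + Real.log (5 / 4) := by
      rw [← Real.log_mul (by norm_num) (by norm_num)]; norm_num
    rw [hy, e]; norm_num at h ⊢; linarith [Real.log_two_gt_d9]
  have hy0 : 0 < y := by linarith
  -- this width of the slices minimizes `exp (L * l ^ 2 / 16) / l`
  set l := √(8 / L) with hl
  have hl2 : l ^ 2 = 8 / L := Real.sq_sqrt (by positivity)
  have hl0 : 0 < l := Real.sqrt_pos.2 (by positivity)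
  have hl1 : l ≤ 1 := by
    rw [hl, Real.sqrt_le_one]; exact (div_le_one hL0).2 hL8
  have hlexp : 1 / l = Real.exp (1 / 2 * (Real.log L - Real.log 8)) := by
    rw [hl, ← Real.log_div (by positivity) (by norm_num), mul_comm, ← Real.rpow_def_of_pos
      (by positivity), ← Real.sqrt_eq_rpow, one_div, ← Real.sqrt_inv, inv_div]
  set θ := 1 - l ^ 2 / 16 with hth
  have hthL : θ = 1 - 1 / (2 * L) := by rw [hth, hl2]; field_simp; ring
  have hth1 : 15 / 16 ≤ θ := by
    rw [hth]; nlinarith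
  set b : ℕ → ℝ := fun j => L + 0.75 * Real.log L + 1.5 * Real.log (y + j * l) with hbdef
  have hyj : ∀ j : ℕ, 1 ≤ y + j * l := fun j => by
    have : (0 : ℝ) ≤ j * l := by positivity
    linarith
  have hb8 : ∀ j, 8 ≤ b j := by
    intro j
    have := Real.log_nonneg (hyj j)
    simp only [hbdef]; linarith
  set A := Real.exp (-(θ * (L + 0.75 * Real.log L))) with hA
  have hbA : ∀ j : ℕ, Real.exp (-(θ * b j)) ≤ A * (y + j * l) ^ (-(7 / 5) : ℝ) := by
    intro j
    rw [hA, Real.rpow_def_of_pos (by linarith [hyj j]), ← Real.exp_add]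
    refine Real.exp_le_exp.2 ?_
    have := Real.log_nonneg (hyj j)
    simp only [hbdef]
    nlinarith
  -- by the choice of `l`, the left side is at most `d * exp (1/2 - 45/64 * log 8)`
  have hAl : A / l ≤ d * 0.385 := by
    have hd : d = Real.exp (-L) := by
      rw [hL, one_div, Real.log_inv, neg_neg, Real.exp_log hd0]
    have h96 : Real.exp (-0.955) ≤ 0.385 := by
      have : (2.598 : ℝ) ≤ Real.exp 0.955 := by
        have := Real.sum_le_exp_of_nonneg (x := 0.955) (by norm_num) 8
        refine le_trans ?_ this
        norm_num [Finset.sum_range_succ, Nat.factorial]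
      rw [Real.exp_neg, inv_eq_one_div, div_le_iff₀ (Real.exp_pos _)]
      linarith
    have hexp : A / l = d * Real.exp (1 / 2 + 3 / 8 * (Real.log L / L) - 1 / 4 * Real.log L
        - 1 / 2 * Real.log 8) := by
      rw [div_eq_mul_one_div, hlexp, hA, hd, ← Real.exp_add, ← Real.exp_add, hthL]
      congr 1; field_simp; ring
    rw [hexp]
    refine mul_le_mul_of_nonneg_left (le_trans (Real.exp_le_exp.2 ?_) h96) hd0.le
    have : Real.log L / L ≤ Real.log L / 8 := by
      apply div_le_div_of_nonneg_left (by linarith) (by norm_num) hL8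
    norm_num at hlog8 ⊢
    linarith
  have hAd : A ≤ d * 0.385 := by
    refine le_trans ?_ hAl
    rw [le_div_iff₀ hl0]
    have : 0 < A := Real.exp_pos _
    nlinarith
  have hmain := measure_exists_curve_le_of_rpow hX hind hsub (l := l) (t₀ := 5) (y := y)
    (A := A) hl0 (by norm_num) hy0 (Real.exp_pos _).le (b := b)
    (fun j => by linarith [hb8 j])
    (x := fun u => √(u * betaSmall u d / 2)) ?_ hbA
    (fun j => by nlinarith [hb8 j])
  · have hy25 : y ^ (-(2 / 5) : ℝ) ≤ 0.78 := by
      rw [← pow_le_pow_iff_left₀ (Real.rpow_nonneg hy0.le _) (by norm_num) (n := 5) (by norm_num),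
        ← Real.rpow_natCast, ← Real.rpow_mul hy0.le]
      have : (-(2 / 5) : ℝ) * ((5 : ℕ) : ℝ) = -((2 : ℕ) : ℝ) := by norm_num
      rw [this, Real.rpow_neg hy0.le, Real.rpow_natCast, inv_eq_one_div,
        div_le_iff₀ (by positivity)]
      have : (1.89 : ℝ) ^ 2 ≤ y ^ 2 := by gcongr
      refine le_trans ?_ (mul_le_mul_of_nonneg_left this (by norm_num))
      norm_num
    have hy75 : y ^ (-(7 / 5) : ℝ) ≤ 0.42 := by
      have : (-(7 / 5) : ℝ) = -(2 / 5) - 1 := by norm_num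
      rw [this, Real.rpow_sub_one hy0.ne', div_le_iff₀ hy0]
      linarith
    have htot : A * (y ^ (-(7 / 5) : ℝ) + 5 / 2 / l * y ^ (-(2 / 5) : ℝ)) ≤ 0.95 * d := by
      have hA0 : 0 < A := Real.exp_pos _
      calc A * (y ^ (-(7 / 5) : ℝ) + 5 / 2 / l * y ^ (-(2 / 5) : ℝ))
          = A * y ^ (-(7 / 5) : ℝ) + 5 / 2 * (A / l * y ^ (-(2 / 5) : ℝ)) := by ring
        _ ≤ d * 0.385 * 0.42 + 5 / 2 * (d * 0.385 * 0.78) := by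
          have := Real.rpow_nonneg hy0.le (-(2 / 5))
          have := Real.rpow_nonneg hy0.le (-(7 / 5))
          gcongr
        _ ≤ _ := by nlinarith
    have hset : ∀ c : ℝ, 1 ≤ c → {ω | ∃ u : ℕ, 1 ≤ u ∧ c * √(u * betaSmall u d / 2) ≤
        ∑ v ∈ Finset.range u, X v ω} ⊆ {ω | ∃ u : ℕ, (5 : ℝ) ≤ u ∧
        c * √(u * betaSmall u d / 2) ≤ ∑ v ∈ Finset.range u, X v ω} := by
      rintro c hc ω ⟨u, hu, hle⟩
      refine ⟨u, ?_, hle⟩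
      by_contra hu5
      have hu4 : u ≤ 4 := by
        have : u < 5 := by exact_mod_cast not_le.1 hu5
        omega
      have hu0 : (0 : ℝ) < u := by exact_mod_cast hu
      have hS : ∑ v ∈ Finset.range u, X v ω < u := by
        have := Finset.sum_lt_sum_of_nonempty (s := Finset.range u) (by simp; omega)
          (fun v _ => hlt v ω)
        simpa using this
      have hβ : 2 * (u : ℝ) ≤ betaSmall u d := by
        rw [betaSmall, ← hL]
        rcases hu.eq_or_lt with rfl | hu2
        · have h2 : (0.3 : ℝ) ≤ 1 + Real.log ((1 : ℕ) / 2) := by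
            rw [Nat.cast_one, one_div, Real.log_inv]; linarith [Real.log_two_lt_d9]
          have h3 := Real.one_sub_inv_le_log_of_pos (x := 0.3) (by norm_num)
          have h4 := Real.log_le_log (by norm_num) h2
          norm_num at h3 h4 ⊢
          linarith
        · have h2 : (1 : ℝ) ≤ (u : ℝ) / 2 := by
            rw [le_div_iff₀ (by norm_num)]; norm_num; exact hu2
          have h3 := Real.log_nonneg (x := 1 + Real.log ((u : ℝ) / 2))
            (by linarith [Real.log_nonneg h2])
          have : (u : ℝ) ≤ 4 := by exact_mod_cast hu4
          linarith
      have : (u : ℝ) ≤ √(u * betaSmall u d / 2) := by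
        refine Real.le_sqrt_of_sq_le ?_
        have := mul_le_mul_of_nonneg_left hβ hu0.le
        linarith
      have := mul_le_mul_of_nonneg_right hc (hu0.le.trans this)
      linarith
    have h1 := hset 1 le_rfl
    simp only [one_mul] at h1
    refine ⟨(measure_mono h1).trans (hmain.1.trans (ENNReal.ofReal_le_ofReal htot)),
      (measure_mono (hset 2 (by norm_num))).trans (hmain.2.trans
      (ENNReal.ofReal_le_ofReal ?_))⟩
    have : A / 19 * (y ^ (-(7 / 5) : ℝ) + 5 / 2 / l * y ^ (-(2 / 5) : ℝ)) =
      A * (y ^ (-(7 / 5) : ℝ) + 5 / 2 / l * y ^ (-(2 / 5) : ℝ)) / 19 := by ring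
    rw [this]; linarith
  · intro u j hu hj
    have hu0 : (0 : ℝ) < u := by linarith
    refine Real.sqrt_le_sqrt ?_
    have : b j ≤ betaSmall u d := by
      simp only [hbdef, betaSmall]
      have e : Real.log ((u : ℝ) / 2) = Real.log (5 / 2) + Real.log (u / 5) := by
        rw [← Real.log_mul (by norm_num) (by positivity)]; congr 1; ring
      rw [e, ← add_assoc, ← hy, ← hL]
      have := hyj j
      gcongr
    gcongr

end Probability

section Confidence

open ProbabilityTheory

variable {n : ℕ}

/-! ### The comparisons with one item -/

theorem measurable_winIndicator (i : Fin n) (v : ℕ) :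
    Measurable fun ω : Outcomes n => winIndicator ω i v := by
  have : Measurable fun p : Fin n × Bool => if p.2 = true then (1 : ℝ) else 0 :=
    measurable_of_finite _
  exact this.comp (measurable_pi_apply (i, v))

theorem winIndicator_mem_Icc (ω : Outcomes n) (i : Fin n) (v : ℕ) :
    winIndicator ω i v ∈ Set.Icc (0 : ℝ) 1 := by
  unfold winIndicator; split_ifs <;> simp

theorem integral_win_comparisonLaw (hn : 2 ≤ n) {M : Matrix (Fin n) (Fin n) ℝ}
    (hM : M ∈ comparisonClass n 0) (i : Fin n) :
    ∫ p, (if p.2 = true then (1 : ℝ) else 0) ∂comparisonLaw M i = score M i := by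
  have hn' : (0 : ℝ) < (n : ℝ) - 1 := by
    have : (2 : ℝ) ≤ n := by exact_mod_cast hn
    linarith
  have hfin : ∀ j ∈ Finset.univ.erase i, Integrable
      (fun p : Fin n × Bool => if p.2 = true then (1 : ℝ) else 0)
      (ENNReal.ofReal (1 / ((n : ℝ) - 1)) •
      (ENNReal.ofReal (M i j) • Measure.dirac (j, true) +
      ENNReal.ofReal (1 - M i j) • Measure.dirac (j, false))) := by
    intro j _
    refine Integrable.smul_measure (Integrable.add_measure ?_ ?_) ENNReal.ofReal_ne_top <;>
    exact (integrable_dirac (by simp)).smul_measure ENNReal.ofReal_ne_top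
  rw [comparisonLaw, integral_finsetSum_measure hfin, score, Finset.mul_sum]
  refine Finset.sum_congr rfl fun j _ => ?_
  rw [integral_smul_measure, integral_add_measure, integral_smul_measure, integral_smul_measure,
    integral_dirac, integral_dirac, ENNReal.toReal_ofReal (by positivity),
    ENNReal.toReal_ofReal (hM i j).1.le]
  · simp
  · exact (integrable_dirac (by simp)).smul_measure ENNReal.ofReal_ne_top
  · exact (integrable_dirac (by simp)).smul_measure ENNReal.ofReal_ne_top

theorem score_mem_Ioo (hn : 2 ≤ n) {M : Matrix (Fin n) (Fin n) ℝ}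
    (hM : M ∈ comparisonClass n 0) (i : Fin n) : score M i ∈ Set.Ioo (0 : ℝ) 1 := by
  have hn' : (0 : ℝ) < (n : ℝ) - 1 := by
    have : (2 : ℝ) ≤ n := by exact_mod_cast hn
    linarith
  have hcard : ((Finset.univ.erase i).card : ℝ) = (n : ℝ) - 1 := by
    rw [Finset.card_erase_of_mem (Finset.mem_univ i), Finset.card_univ, Fintype.card_fin,
      Nat.cast_sub (by omega), Nat.cast_one]
  have hne : (Finset.univ.erase i).Nonempty := by
    rw [← Finset.card_pos]; rw [← hcard] at hn'; exact_mod_cast hn'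
  constructor
  · exact mul_pos (by positivity) (Finset.sum_pos (fun j _ => (hM i j).1) hne)
  · rw [score, one_div_mul_eq_div, div_lt_one hn', ← hcard]
    have := Finset.sum_lt_sum_of_nonempty hne fun j _ => (hM i j).2.1
    simpa using this

theorem isProbabilityMeasure_outcomesLaw (hn : 2 ≤ n) {M : Matrix (Fin n) (Fin n) ℝ}
    (hM : M ∈ comparisonClass n 0) : IsProbabilityMeasure (outcomesLaw M) := by
  have : ∀ p : Fin n × ℕ, IsProbabilityMeasure (comparisonLaw M p.1) :=
    fun p => isProbabilityMeasure_comparisonLaw hn hM p.1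
  unfold outcomesLaw; infer_instance

theorem integral_winIndicator (hn : 2 ≤ n) {M : Matrix (Fin n) (Fin n) ℝ}
    (hM : M ∈ comparisonClass n 0) (i : Fin n) (v : ℕ) :
    ∫ ω, winIndicator ω i v ∂outcomesLaw M = score M i := by
  have : ∀ p : Fin n × ℕ, IsProbabilityMeasure (comparisonLaw M p.1) :=
    fun p => isProbabilityMeasure_comparisonLaw hn hM p.1
  have hmp := measurePreserving_eval_infinitePi (fun p : Fin n × ℕ => comparisonLaw M p.1) (i, v)
  rw [← integral_win_comparisonLaw hn hM i, ← hmp.map_eq, integral_map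
    (measurable_pi_apply _).aemeasurable (measurable_of_finite _).aestronglyMeasurable]
  rfl

theorem iIndepFun_winIndicator (hn : 2 ≤ n) {M : Matrix (Fin n) (Fin n) ℝ}
    (hM : M ∈ comparisonClass n 0) (i : Fin n) :
    iIndepFun (fun v (ω : Outcomes n) => winIndicator ω i v) (outcomesLaw M) := by
  have : ∀ p : Fin n × ℕ, IsProbabilityMeasure (comparisonLaw M p.1) :=
    fun p => isProbabilityMeasure_comparisonLaw hn hM p.1
  have h := iIndepFun_infinitePi (P := fun p : Fin n × ℕ => comparisonLaw M p.1)
    (X := fun _ (p : Fin n × Bool) => if p.2 = true then (1 : ℝ) else 0)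
    (fun _ => measurable_of_finite _)
  exact h.precomp (g := fun v : ℕ => (i, v)) fun a b hab => congrArg Prod.snd hab

theorem hasSubgaussianMGF_winIndicator (hn : 2 ≤ n) {M : Matrix (Fin n) (Fin n) ℝ}
    (hM : M ∈ comparisonClass n 0) (i : Fin n) (v : ℕ) :
    HasSubgaussianMGF (fun ω : Outcomes n => winIndicator ω i v - score M i) (1 / 4)
      (outcomesLaw M) := by
  have := isProbabilityMeasure_outcomesLaw hn hM
  have h := hasSubgaussianMGF_of_mem_Icc (μ := outcomesLaw M) (a := 0) (b := 1)
    (measurable_winIndicator i v).aemeasurable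
    (Filter.Eventually.of_forall fun ω => winIndicator_mem_Icc ω i v)
  rw [integral_winIndicator hn hM] at h
  convert h using 1
  rw [sub_zero, nnnorm_one]; norm_num

/-! ### Simultaneous confidence bounds -/

/-- The fraction of its first `u` comparisons that item `i` wins. -/
def winRate (ω : Outcomes n) (i : Fin n) (u : ℕ) : ℝ :=
  (∑ v ∈ Finset.range u, winIndicator ω i v) / u

/-- The admissible pairs of a confidence parameter and a confidence function. -/
def IsConfidence (δ : ℝ) (β : ℕ → ℝ → ℝ) : Prop :=
  (0 < δ ∧ δ < 0.0005 ∧ β = betaSmall) ∨ (0 < δ ∧ δ < 1 ∧ β = betaAll)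

theorem IsConfidence.pos {δ : ℝ} {β : ℕ → ℝ → ℝ} (h : IsConfidence δ β) : 0 < δ := by
  rcases h with h | h <;> exact h.1

theorem IsConfidence.lt_one {δ : ℝ} {β : ℕ → ℝ → ℝ} (h : IsConfidence δ β) : δ < 1 := by
  rcases h with h | h
  · exact h.2.1.trans (by norm_num)
  · exact h.2.1

theorem measure_exists_beta_le {Ω : Type*} [MeasurableSpace Ω] {μ : Measure Ω}
    [IsProbabilityMeasure μ] {X : ℕ → Ω → ℝ}
    (hX : ∀ v, Measurable (X v)) (hind : iIndepFun X μ)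
    (hsub : ∀ v, HasSubgaussianMGF (X v) (1 / 4) μ) (hlt : ∀ v ω, X v ω < 1)
    (hn : 2 ≤ n) {δ : ℝ} {β : ℕ → ℝ → ℝ} (hβ : IsConfidence δ β) :
    μ {ω | ∃ u : ℕ, 1 ≤ u ∧ alpha β n δ u ≤ (∑ v ∈ Finset.range u, X v ω) / u} ≤
        ENNReal.ofReal (0.95 * (δ / n)) ∧
      μ {ω | ∃ u : ℕ, 1 ≤ u ∧ 2 * alpha β n δ u ≤ (∑ v ∈ Finset.range u, X v ω) / u} ≤
        ENNReal.ofReal (0.05 * (δ / n)) := by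
  have hn' : (2 : ℝ) ≤ n := by exact_mod_cast hn
  have hrad : ∀ (u : ℕ), 1 ≤ u → alpha β n δ u = √(u * β u (δ / n) / 2) / u := by
    intro u hu
    have hu0 : (0 : ℝ) < u := by exact_mod_cast hu
    rw [alpha, eq_div_iff hu0.ne', ← Real.sqrt_sq hu0.le, ← Real.sqrt_mul' _ (sq_nonneg _),
      Real.sqrt_sq hu0.le]
    congr 1; field_simp
  have hset : ∀ c : ℝ,
      {ω | ∃ u : ℕ, 1 ≤ u ∧ c * alpha β n δ u ≤ (∑ v ∈ Finset.range u, X v ω) / u} =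
      {ω | ∃ u : ℕ, 1 ≤ u ∧ c * √(u * β u (δ / n) / 2) ≤ ∑ v ∈ Finset.range u, X v ω} := by
    intro c; ext ω
    refine exists_congr fun u => and_congr_right fun hu => ?_
    have hu0 : (0 : ℝ) < u := by exact_mod_cast hu
    rw [hrad u hu, ← mul_div_assoc, div_le_div_iff_of_pos_right hu0]
  have h1 := hset 1
  simp only [one_mul] at h1
  rw [h1, hset 2]
  have hd0 : 0 < δ / n := div_pos hβ.pos (by linarith)
  rcases hβ with ⟨h0, h2, rfl⟩ | ⟨h0, h2, rfl⟩
  · refine measure_exists_betaSmall_le hX hind hsub hlt hd0 ?_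
    rw [div_lt_iff₀ (by linarith)]; norm_num at h2; linarith
  · refine measure_exists_betaAll_le hX hind hsub hd0 ?_
    rw [div_lt_one (by linarith)]; linarith

/-- The event on which the algorithm behaves well: the scores of the items in `S` are never
underestimated by as much as the confidence radius, those of the other items are never
overestimated by as much, and no error is as large as twice the radius. -/
def Concentrated (M : Matrix (Fin n) (Fin n) ℝ) (α : ℕ → ℝ) (S : Finset (Fin n))
    (ω : Outcomes n) : Prop :=
  ∀ i u, 1 ≤ u →
    (|winRate ω i u - score M i| ≤ 2 * α u) ∧
    (i ∈ S → score M i ≤ winRate ω i u + α u) ∧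
    (i ∉ S → winRate ω i u - α u < score M i)

theorem measure_not_concentrated_le (hn : 2 ≤ n) {M : Matrix (Fin n) (Fin n) ℝ}
    (hM : M ∈ comparisonClass n 0) {δ : ℝ} {β : ℕ → ℝ → ℝ} (hβ : IsConfidence δ β)
    (S : Finset (Fin n)) :
    outcomesLaw M {ω | ¬ Concentrated M (alpha β n δ) S ω} ≤ ENNReal.ofReal δ := by
  have := isProbabilityMeasure_outcomesLaw hn hM
  have hn0 : (0 : ℝ) < n := by have : (2 : ℝ) ≤ n := by exact_mod_cast hn
                               linarith
  set α := alpha β n δ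
  have hα : ∀ u, 0 ≤ α u := fun u => Real.sqrt_nonneg _
  have hsub := hasSubgaussianMGF_winIndicator hn hM
  have hup := fun i => measure_exists_beta_le (μ := outcomesLaw M) (n := n)
    (X := fun v ω => winIndicator ω i v - score M i)
    (fun v => (measurable_winIndicator i v).sub_const _)
    ((iIndepFun_winIndicator hn hM i).comp (fun _ x => x - score M i) fun _ => by fun_prop)
    (hsub i)
    (fun v ω => by linarith [(winIndicator_mem_Icc ω i v).2, (score_mem_Ioo hn hM i).1]) hn hβ
  have hlow := fun i => measure_exists_beta_le (μ := outcomesLaw M) (n := n)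
    (X := fun v ω => -(winIndicator ω i v - score M i))
    (fun v => ((measurable_winIndicator i v).sub_const _).neg)
    ((iIndepFun_winIndicator hn hM i).comp (fun _ x => -(x - score M i)) fun _ => by fun_prop)
    (fun v => (hsub i v).neg)
    (fun v ω => by linarith [(winIndicator_mem_Icc ω i v).1, (score_mem_Ioo hn hM i).2]) hn hβ
  have havg : ∀ (i : Fin n) (u : ℕ) (ω : Outcomes n), 1 ≤ u →
      (∑ v ∈ Finset.range u, (winIndicator ω i v - score M i)) / u =
        winRate ω i u - score M i := by
    intro i u ω hu
    have hu0 : (u : ℝ) ≠ 0 := by positivity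
    rw [Finset.sum_sub_distrib, sub_div, winRate]
    simp [hu0]
  set U : Fin n → ℝ → Set (Outcomes n) := fun i c => {ω | ∃ u : ℕ, 1 ≤ u ∧
    c * α u ≤ (∑ v ∈ Finset.range u, (winIndicator ω i v - score M i)) / u} with hU
  set V : Fin n → ℝ → Set (Outcomes n) := fun i c => {ω | ∃ u : ℕ, 1 ≤ u ∧
    c * α u ≤ (∑ v ∈ Finset.range u, -(winIndicator ω i v - score M i)) / u} with hV
  have hcov : {ω | ¬ Concentrated M α S ω} ⊆
      ⋃ i, (if i ∈ S then V i 1 ∪ U i 2 else U i 1 ∪ V i 2) := by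
    intro ω hω
    by_contra hnot
    apply hω
    intro i u hu
    have hi : ω ∉ (if i ∈ S then V i 1 ∪ U i 2 else U i 1 ∪ V i 2) :=
      fun h => hnot (Set.mem_iUnion.2 ⟨i, h⟩)
    have hUn : ∀ c, ω ∉ U i c → winRate ω i u - score M i < c * α u := by
      intro c hc
      by_contra hle
      exact hc ⟨u, hu, by rw [havg i u ω hu]; exact not_lt.1 hle⟩
    have hVn : ∀ c, ω ∉ V i c → -(winRate ω i u - score M i) < c * α u := by
      intro c hc
      by_contra hle
      refine hc ⟨u, hu, ?_⟩
      rw [Finset.sum_neg_distrib, neg_div, havg i u ω hu]; exact not_lt.1 hle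
    have := hα u
    split_ifs at hi with hS
    · have h1 := hVn 1 fun h => hi (Or.inl h)
      have h2 := hUn 2 fun h => hi (Or.inr h)
      exact ⟨abs_le.2 ⟨by linarith, by linarith⟩, fun _ => by linarith, fun h => absurd hS h⟩
    · have h1 := hUn 1 fun h => hi (Or.inl h)
      have h2 := hVn 2 fun h => hi (Or.inr h)
      exact ⟨abs_le.2 ⟨by linarith, by linarith⟩, fun h => absurd h hS, fun _ => by linarith⟩
  have hsum : ENNReal.ofReal (0.95 * (δ / n)) + ENNReal.ofReal (0.05 * (δ / n)) =
      ENNReal.ofReal (δ / n) := by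
    have : 0 ≤ δ / n := div_nonneg hβ.pos.le hn0.le
    rw [← ENNReal.ofReal_add (by positivity) (by positivity)]
    congr 1; ring
  calc outcomesLaw M {ω | ¬ Concentrated M α S ω}
      ≤ ∑ i, outcomesLaw M (if i ∈ S then V i 1 ∪ U i 2 else U i 1 ∪ V i 2) :=
        (measure_mono hcov).trans (measure_iUnion_fintype_le _ _)
    _ ≤ ∑ _i : Fin n, ENNReal.ofReal (δ / n) := by
        refine Finset.sum_le_sum fun i _ => ?_
        rw [← hsum]
        split_ifs
        · refine (measure_union_le _ _).trans (add_le_add ?_ (hup i).2)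
          simpa [hV] using (hlow i).1
        · refine (measure_union_le _ _).trans (add_le_add ?_ (hlow i).2)
          simpa [hU] using (hup i).1
    _ = ENNReal.ofReal δ := by
        rw [Finset.sum_const, Finset.card_univ, Fintype.card_fin, nsmul_eq_mul,
          ← ENNReal.ofReal_natCast, ← ENNReal.ofReal_mul hn0.le, mul_div_cancel₀ _ hn0.ne']

end Confidence

variable {n : ℕ}

/-! ### Sets of ranked items -/

theorem mem_ranked {σ : Equiv.Perm (Fin n)} {a b : ℕ} {i : Fin n} :
    i ∈ ranked σ a b ↔ a ≤ (σ.symm i).val + 1 ∧ (σ.symm i).val + 1 ≤ b := by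
  simp only [ranked, Finset.mem_image, Finset.mem_filter, Finset.mem_univ, true_and]
  constructor
  · rintro ⟨r, hr, rfl⟩; simpa using hr
  · intro h; exact ⟨σ.symm i, h, by simp⟩

theorem card_ranked_eq (σ σ' : Equiv.Perm (Fin n)) (a b : ℕ) :
    (ranked σ a b).card = (ranked σ' a b).card := by
  rw [ranked, ranked, Finset.card_image_of_injective _ σ.injective,
    Finset.card_image_of_injective _ σ'.injective]

theorem card_ranked_le (σ : Equiv.Perm (Fin n)) (a b : ℕ) :
    (ranked σ a b).card ≤ b + 1 - a := by
  rw [← Nat.card_Icc]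
  refine Finset.card_le_card_of_injOn (fun i => (σ.symm i).val + 1) ?_ ?_
  · intro i hi
    simpa [mem_ranked] using hi
  · intro i _ j _ hij
    exact σ.symm.injective (Fin.ext (by simpa using hij))

theorem ranked_compl (σ : Equiv.Perm (Fin n)) (k : ℕ) :
    ranked σ (k + 1) n = (ranked σ 1 k)ᶜ := by
  ext i
  have := (σ.symm i).isLt
  simp only [Finset.mem_compl, mem_ranked]
  omega

/-! ### Accuracy of the returned ranking -/

/-- The state stores the fraction of comparisons won, for every item. -/
def State.Faithful (ω : Outcomes n) (s : State n) : Prop :=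
  ∀ i, 1 ≤ s.count i ∧ s.est i = winRate ω i (s.count i)

theorem State.Faithful.compare {ω : Outcomes n} {s : State n} (hs : s.Faithful ω) (i : Fin n) :
    (s.compare ω i).Faithful ω := by
  intro j
  by_cases hij : j = i
  · subst hij
    have h1 := hs j
    have h0 : (0 : ℝ) < s.count j := by exact_mod_cast h1.1
    refine ⟨by simp [State.compare], ?_⟩
    simp only [State.compare, Function.update_self, h1.2, winRate, Finset.sum_range_succ]
    push_cast
    field_simp
  · simpa [State.compare, hij] using hs j

theorem Rule.faithful_state {k h : ℕ} {α : ℕ → ℝ} (R : Rule n k h α) (ω : Outcomes n) (t : ℕ) :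
    (R.state ω t).Faithful ω := by
  induction t with
  | zero => intro i; simp [Rule.state, initState, winRate]
  | succ t ih => exact (ih.compare _).compare _

theorem score_le_of_mem_of_notMem {M : Matrix (Fin n) (Fin n) ℝ} {π : Equiv.Perm (Fin n)}
    (hπ : IsSorting (score M) π) {k : ℕ} {a b : Fin n} (hb : b ∈ ranked π 1 k)
    (ha : a ∉ ranked π 1 k) : score M a ≤ score M b := by
  rw [mem_ranked] at ha hb
  have hle : π.symm b ≤ π.symm a := by rw [Fin.le_def]; omega
  simpa using hπ hle

theorem hammingAccurate_of_card_sdiff_le {k h : ℕ} (σ π : Equiv.Perm (Fin n))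
    (hcard : (ranked σ 1 k \ ranked π 1 k).card ≤ h) :
    HammingAccurate k h π (ranked σ 1 k) (ranked σ (k + 1) n) := by
  have hsym : ∀ S S' : Finset (Fin n), (S ∪ S') \ (S ∩ S') = (S \ S') ∪ (S' \ S) := by
    intro S S'; ext i; simp only [Finset.mem_sdiff, Finset.mem_union, Finset.mem_inter]; tauto
  have hdist : hammingDistance (ranked σ 1 k) (ranked π 1 k) ≤ 2 * h := by
    have hc := Finset.card_sdiff_comm (card_ranked_eq σ π 1 k)
    rw [hammingDistance, hsym]
    refine (Finset.card_union_le _ _).trans ?_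
    omega
  refine ⟨⟨card_ranked_eq _ _ _ _, card_ranked_eq _ _ _ _⟩, hdist, ?_⟩
  have : hammingDistance (ranked σ (k + 1) n) (ranked π (k + 1) n) =
      hammingDistance (ranked σ 1 k) (ranked π 1 k) := by
    rw [hammingDistance, hammingDistance, ranked_compl, ranked_compl]
    congr 1
    ext i; simp only [Finset.mem_sdiff, Finset.mem_union, Finset.mem_inter, Finset.mem_compl]
    tauto
  rw [this]; exact hdist

/-- If more than `h` items were misplaced, then one of them would be among the first `k - h` and
another among the last `n - k - h`; the termination condition compares these two. -/
theorem Rule.accurateAt_of_terminated {k h : ℕ} {α : ℕ → ℝ} (R : Rule n k h α)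
    {M : Matrix (Fin n) (Fin n) ℝ} {π : Equiv.Perm (Fin n)} (hπ : IsSorting (score M) π)
    {ω : Outcomes n} (hω : Concentrated M α (ranked π 1 k) ω) {t : ℕ}
    (ht : R.Terminated ω t) : R.AccurateAt π ω t := by
  refine hammingAccurate_of_card_sdiff_le _ _ ?_
  by_contra! hcard
  obtain ⟨-, hd₁, hd₂, -, -⟩ := R.isSelection t (R.state ω t)
  have hfaith := R.faithful_state ω t
  set s := R.state ω t with hs
  have hc : R.selection ω t = R.select t s := rfl
  rw [Rule.Terminated, hc] at ht
  rw [hc] at hcard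
  set c := R.select t s
  obtain ⟨a, ha, ha'⟩ := Finset.exists_mem_notMem_of_card_lt_card
    (lt_of_le_of_lt (card_ranked_le c.σ (k - h + 1) k) (by omega :
      k + 1 - (k - h + 1) < (ranked c.σ 1 k \ ranked π 1 k).card))
  have hcard' : h < (ranked π 1 k \ ranked c.σ 1 k).card := by
    rwa [Finset.card_sdiff_comm (card_ranked_eq π c.σ 1 k)]
  obtain ⟨b, hb, hb'⟩ := Finset.exists_mem_notMem_of_card_lt_card
    (lt_of_le_of_lt (card_ranked_le c.σ (k + 1) (k + h)) (by omega :
      k + h + 1 - (k + 1) < (ranked π 1 k \ ranked c.σ 1 k).card))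
  rw [Finset.mem_sdiff] at ha hb
  have ha1 : a ∈ ranked c.σ 1 (k - h) := by
    have := ha.1
    rw [mem_ranked] at this ha' ⊢; omega
  have hb1 : b ∈ ranked c.σ (k + 1 + h) n := by
    have := hb.2
    have := (c.σ.symm b).isLt
    rw [mem_ranked] at *; omega
  have h1 := hd₁.2 a ha1
  have h2 := hd₂.2 b hb1
  have h3 := (hω a _ (hfaith a).1).2.2 ha.2
  have h4 := (hω b _ (hfaith b).1).2.1 hb.1
  rw [← (hfaith a).2] at h3
  rw [← (hfaith b).2] at h4
  have h5 := score_le_of_mem_of_notMem hπ hb.1 ha.2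
  simp only at h1 h2
  linarith

/-! ### Progress in every round -/

/-- If `D` contains no item of `B`, then `B` cannot be the set of the items estimated to be last,
since it misses `d₂`; so some item `j` of `B` is estimated to be in the top group, and `d₁` is
estimated even lower than `j`, up to the radii. -/
theorem exists_mem_forall_le_add {e r τ : Fin n → ℝ} {a : ℝ} {D B Bhat That : Finset (Fin n)}
    {d₁ d₂ : Fin n} (hcard : Bhat.card = B.card) (hd₂ : d₂ ∈ Bhat) (hd₁D : d₁ ∈ D) (hd₂D : d₂ ∈ D)
    (hcover : ∀ j, j ∉ Bhat → j ∈ D ∨ j ∈ That) (hr : ∀ i ∈ D, r i ≤ a)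
    (hconc : ∀ i ∈ D, |e i - τ i| ≤ 2 * r i)
    (hwin : ∀ i ∈ D, ∀ i' ∈ D, |e i - e i'| ≤ 2 * a)
    (hmin : ∀ j ∈ That, e d₁ - r d₁ ≤ e j - r j) (hB : ∀ j ∈ B, e j - r j ≤ τ j) :
    ∃ j ∈ B, ∀ i ∈ D, τ i ≤ τ j + 9 * a := by
  have ha : 0 ≤ a := by linarith [abs_nonneg (e d₁ - τ d₁), hconc d₁ hd₁D, hr d₁ hd₁D]
  have hτ : ∀ i ∈ D, ∀ i' ∈ D, τ i ≤ τ i' + 6 * a := by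
    intro i hi i' hi'
    have h1 := abs_le.1 (hconc i hi)
    have h2 := abs_le.1 (hconc i' hi')
    have h3 := abs_le.1 (hwin i hi i' hi')
    linarith [hr i hi, hr i' hi']
  by_cases hDB : ∃ j ∈ D, j ∈ B
  · obtain ⟨j, hjD, hjB⟩ := hDB
    exact ⟨j, hjB, fun i hi => by linarith [hτ i hi j hjD]⟩
  · push Not at hDB
    obtain ⟨j, hjB, hj⟩ : ∃ j ∈ B, j ∉ Bhat := by
      by_contra! hsub
      have := Finset.eq_of_subset_of_card_le hsub hcard.le
      exact hDB d₂ hd₂D (this ▸ hd₂)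
    have hjT := (hcover j hj).resolve_left fun h => hDB j h hjB
    refine ⟨j, hjB, fun i hi => ?_⟩
    have h1 := abs_le.1 (hconc d₁ hd₁D)
    linarith [hτ i hi d₁ hd₁D, hmin j hjT, hB j hjB, hr d₁ hd₁D]

/-- The gap which determines how often the item of rank `r` is compared: to the rank `bot` for the
ranks up to `top`, to the rank `top` for those from `bot` on, and between `top` and `bot`
otherwise. -/
def itemGap (M : Matrix (Fin n) (Fin n) ℝ) (π : Equiv.Perm (Fin n)) (top bot r : Fin n) : ℝ :=
  if r ≤ top then gap M π r bot else if bot ≤ r then gap M π top r else gap M π top bot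

/-- As long as the algorithm does not stop, the one of `b₁`, `b₂` with the larger radius is an item
whose radius is not yet small compared to its gap. -/
theorem exists_itemGap_le {k h : ℕ} {α : ℕ → ℝ}
    {M : Matrix (Fin n) (Fin n) ℝ} {π : Equiv.Perm (Fin n)} (hπ : IsSorting (score M) π)
    {ω : Outcomes n} (hω : Concentrated M α (ranked π 1 k) ω) {top bot : Fin n}
    (htop : top.val + 1 = k - h) (hbot : bot.val + 1 = k + 1 + h) {s : State n}
    (hs : s.Faithful ω) {c : Selection n} (hc : IsSelection α k h s c)
    (hnot : s.est c.d₁ - α (s.count c.d₁) < s.est c.d₂ + α (s.count c.d₂)) :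
    ∃ b, (b = c.b₁ ∨ b = c.b₂) ∧ itemGap M π top bot (π.symm b) ≤ 18 * α (s.count b) := by
  obtain ⟨hσ, hd₁, hd₂, hb₁, hb₂⟩ := hc
  set r : Fin n → ℝ := fun i => α (s.count i) with hr
  set D₁ := insert c.d₁ (ranked c.σ (k - h + 1) k)
  set D₂ := insert c.d₂ (ranked c.σ (k + 1) (k + h))
  set D := D₁ ∪ D₂ with hD
  obtain ⟨b, hb, hbD, hbmax⟩ : ∃ b, (b = c.b₁ ∨ b = c.b₂) ∧ b ∈ D ∧ ∀ i ∈ D, r i ≤ r b := by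
    rcases le_total (r c.b₁) (r c.b₂) with hle | hle
    · refine ⟨c.b₂, Or.inr rfl, Finset.mem_union_right _ hb₂.1, fun i hi => ?_⟩
      rcases Finset.mem_union.1 hi with hi | hi
      · exact (hb₁.2 i hi).trans hle
      · exact hb₂.2 i hi
    · refine ⟨c.b₁, Or.inl rfl, Finset.mem_union_left _ hb₁.1, fun i hi => ?_⟩
      rcases Finset.mem_union.1 hi with hi | hi
      · exact hb₁.2 i hi
      · exact (hb₂.2 i hi).trans hle
  refine ⟨b, hb, ?_⟩
  set a := r b with ha
  have hd₁D : c.d₁ ∈ D := Finset.mem_union_left _ (Finset.mem_insert_self _ _)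
  have hd₂D : c.d₂ ∈ D := Finset.mem_union_right _ (Finset.mem_insert_self _ _)
  have hmono : ∀ i j, (c.σ.symm i).val ≤ (c.σ.symm j).val → s.est j ≤ s.est i := by
    intro i j hij
    simpa using hσ (Fin.le_def.2 hij)
  have hr1 := mem_ranked.1 hd₁.1
  have hr2 := mem_ranked.1 hd₂.1
  have hbetween : ∀ i ∈ D, s.est c.d₂ ≤ s.est i ∧ s.est i ≤ s.est c.d₁ := by
    intro i hi
    have hi' : i = c.d₁ ∨ i = c.d₂ ∨
        (k - h + 1 ≤ (c.σ.symm i).val + 1 ∧ (c.σ.symm i).val + 1 ≤ k + h) := by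
      simp only [hD, D₁, D₂, Finset.mem_union, Finset.mem_insert, mem_ranked] at hi
      rcases hi with (hi | hi) | (hi | hi)
      · exact Or.inl hi
      · right; right; omega
      · exact Or.inr (Or.inl hi)
      · right; right; omega
    rcases hi' with rfl | rfl | hi'
    · exact ⟨hmono _ _ (by omega), le_rfl⟩
    · exact ⟨le_rfl, hmono _ _ (by omega)⟩
    · exact ⟨hmono _ _ (by omega), hmono _ _ (by omega)⟩
  have hwidth : s.est c.d₁ - s.est c.d₂ ≤ 2 * a := by
    have h1 := hbmax _ hd₁D
    have h2 := hbmax _ hd₂D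
    simp only [hr] at h1 h2
    linarith
  have hwin : ∀ i ∈ D, ∀ i' ∈ D, |s.est i - s.est i'| ≤ 2 * a := by
    intro i hi i' hi'
    have h1 := hbetween i hi
    have h2 := hbetween i' hi'
    exact abs_le.2 ⟨by linarith, by linarith⟩
  have hconc : ∀ i, |s.est i - score M i| ≤ 2 * r i := by
    intro i; rw [(hs i).2]; exact (hω i _ (hs i).1).1
  obtain ⟨j, hjB, hj⟩ := exists_mem_forall_le_add (e := s.est) (r := r) (τ := score M) (a := a)
    (D := D) (B := ranked π (k + 1 + h) n) (Bhat := ranked c.σ (k + 1 + h) n)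
    (That := ranked c.σ 1 (k - h)) (card_ranked_eq _ _ _ _) hd₂.1 hd₁D hd₂D
    (fun j hj => by
      have := (c.σ.symm j).isLt
      simp only [hD, D₁, D₂, Finset.mem_union, Finset.mem_insert, mem_ranked] at hj ⊢
      omega)
    hbmax (fun i _ => hconc i) hwin hd₁.2
    (fun j hj => by
      rw [(hs j).2]
      refine ((hω j _ (hs j).1).2.2 ?_).le
      rw [mem_ranked] at hj ⊢; omega)
  obtain ⟨j', hjT, hj'⟩ := exists_mem_forall_le_add (e := fun i => -s.est i) (r := r)
    (τ := fun i => -score M i) (a := a)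
    (D := D) (B := ranked π 1 (k - h)) (Bhat := ranked c.σ 1 (k - h))
    (That := ranked c.σ (k + 1 + h) n) (card_ranked_eq _ _ _ _) hd₁.1 hd₂D hd₁D
    (fun j hj => by
      have := (c.σ.symm j).isLt
      simp only [hD, D₁, D₂, Finset.mem_union, Finset.mem_insert, mem_ranked] at hj ⊢
      omega)
    hbmax
    (fun i _ => by rw [← abs_neg]; simpa [neg_add_eq_sub, abs_sub_comm] using hconc i)
    (fun i hi i' hi' => by
      rw [← abs_neg]
      simpa [neg_add_eq_sub, abs_sub_comm] using hwin i hi i' hi')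
    (fun j hj => by
      have := hd₂.2 j hj
      simp only at this
      simp only [hr]; linarith)
    (fun j hj => by
      have h1 : j ∈ ranked π 1 k := by rw [mem_ranked] at hj ⊢; omega
      have h2 := (hω j _ (hs j).1).2.1 h1
      rw [← (hs j).2] at h2
      simp only [hr]; linarith)
  have hτB : score M j ≤ score M (π bot) := by
    rw [mem_ranked] at hjB
    have : bot ≤ π.symm j := by rw [Fin.le_def]; omega
    simpa using hπ this
  have hτT : score M (π top) ≤ score M j' := by
    rw [mem_ranked] at hjT
    have : π.symm j' ≤ top := by rw [Fin.le_def]; omega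
    simpa using hπ this
  have h1 := hj b hbD
  have h2 := hj' b hbD
  have ha0 : 0 ≤ a := by linarith [abs_nonneg (s.est b - score M b), hconc b]
  simp only [itemGap, gap, Equiv.apply_symm_apply]
  split_ifs <;> linarith

/-! ### The number of rounds -/

theorem State.count_le_count_compare (s : State n) (ω : Outcomes n) (i j : Fin n) :
    s.count j ≤ (s.compare ω i).count j := by
  by_cases hij : j = i
  · subst hij; simp [State.compare]
  · simp [State.compare, hij]

theorem State.count_compare_self (s : State n) (ω : Outcomes n) (i : Fin n) :
    (s.compare ω i).count i = s.count i + 1 := by simp [State.compare]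

theorem State.sum_count_compare (s : State n) (ω : Outcomes n) (i : Fin n) :
    ∑ j, (s.compare ω i).count j = ∑ j, s.count j + 1 := by
  rw [← Finset.add_sum_erase _ _ (Finset.mem_univ i), State.count_compare_self,
    ← Finset.add_sum_erase _ s.count (Finset.mem_univ i)]
  have : ∑ j ∈ Finset.univ.erase i, (s.compare ω i).count j =
      ∑ j ∈ Finset.univ.erase i, s.count j :=
    Finset.sum_congr rfl fun j hj => by simp [State.compare, Finset.ne_of_mem_erase hj]
  omega

namespace Rule

variable {k h : ℕ} {α : ℕ → ℝ} (R : Rule n k h α)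

theorem comparisons_eq (ω : Outcomes n) (t : ℕ) : R.comparisons ω t = n + 2 * t := by
  induction t with
  | zero => simp [comparisons, state, initState]
  | succ t ih =>
    rw [comparisons, state, State.sum_count_compare, State.sum_count_compare]
    rw [comparisons] at ih
    omega

/-- If every round before `t` compares an item `b` that was compared at most `N b` times, then
`∑ b, min (T_b) (N b + 1)` has grown in each of these rounds. -/
theorem le_sum_of_forall_exists (ω : Outcomes n) (N : Fin n → ℕ) {t : ℕ}
    (ht : ∀ t' < t, ∃ b, (b = (R.selection ω t').b₁ ∨ b = (R.selection ω t').b₂) ∧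
      (R.state ω t').count b ≤ N b) :
    t ≤ ∑ b, (N b + 1) := by
  have key : ∀ m ≤ t, m ≤ ∑ b, min ((R.state ω m).count b) (N b + 1) := by
    intro m
    induction m with
    | zero => intro _; exact Nat.zero_le _
    | succ m ih =>
      intro hm
      obtain ⟨b, hb, hbN⟩ := ht m hm
      refine lt_of_le_of_lt (ih (by omega)) (Finset.sum_lt_sum (fun j _ => ?_)
        ⟨b, Finset.mem_univ b, ?_⟩)
      · exact min_le_min_right _ ((State.count_le_count_compare _ ω _ j).trans
          (State.count_le_count_compare _ ω _ j))
      · have hlt : (R.state ω m).count b + 1 ≤ (R.state ω (m + 1)).count b := by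
          rcases hb with rfl | rfl
          · exact (State.count_compare_self _ ω _).symm.le.trans
              (State.count_le_count_compare _ ω _ _)
          · exact (Nat.add_le_add_right (State.count_le_count_compare _ ω _ _) 1).trans
              (State.count_compare_self _ ω _).symm.le
        omega
  exact (key t le_rfl).trans (Finset.sum_le_sum fun b _ => min_le_right _ _)

/-- If the rounds in which the algorithm goes on all compare an item `b` that was compared at
most `N b` times, then the algorithm stops. -/
theorem exists_stopsAt (ω : Outcomes n) (N : Fin n → ℕ)
    (hN : ∀ t, ¬ R.Terminated ω t →
      ∃ b, (b = (R.selection ω t).b₁ ∨ b = (R.selection ω t).b₂) ∧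
        (R.state ω t).count b ≤ N b) :
    ∃ t, R.StopsAt ω t ∧ R.comparisons ω t ≤ n + 2 * ∑ b, (N b + 1) := by
  classical
  have hex : ∃ t, R.Terminated ω t := by
    by_contra! hnot
    have := R.le_sum_of_forall_exists ω N (t := ∑ b, (N b + 1) + 1) fun t' _ => hN t' (hnot t')
    omega
  refine ⟨Nat.find hex, ⟨Nat.find_spec hex, fun t' ht' => Nat.find_min hex ht'⟩, ?_⟩
  have := R.le_sum_of_forall_exists ω N (t := Nat.find hex)
    fun t' ht' => hN t' (Nat.find_min hex ht')
  rw [comparisons_eq]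
  omega

end Rule

/-! ### How many comparisons make a radius small -/

theorem beta_le {β : ℕ → ℝ → ℝ} {δ : ℝ} (hβ : IsConfidence δ β) {Λ : ℝ}
    (hn : 2 ≤ n) (hΛ : Λ = Real.log (n / δ)) {u : ℕ} (hu : 1 ≤ u) :
    β u (δ / n) ≤ 16 * Λ + 2 * Real.log (1 + Real.log u) := by
  have hn' : (2 : ℝ) ≤ n := by exact_mod_cast hn
  have hu' : (1 : ℝ) ≤ u := by exact_mod_cast hu
  have hδ := hβ.pos
  have hlogu : 0 ≤ Real.log u := Real.log_nonneg hu'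
  have hlog2 := Real.log_two_gt_d9
  have hΛ2 : Real.log 2 ≤ Λ := by
    rw [hΛ]
    refine Real.log_le_log (by norm_num) ?_
    rw [le_div_iff₀ hδ]; nlinarith [hβ.lt_one]
  have hinv : Real.log (1 / (δ / n)) = Λ := by rw [hΛ, one_div_div]
  have hll : 0 ≤ Real.log (1 + Real.log u) := Real.log_nonneg (by linarith)
  rcases hβ with ⟨-, -, rfl⟩ | ⟨-, -, rfl⟩
  · rw [betaSmall, hinv]
    have h1 : Real.log Λ ≤ Λ := (Real.log_le_sub_one_of_pos (by linarith)).trans (by linarith)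
    have h2 : Real.log (1 + Real.log ((u : ℝ) / 2)) ≤ Real.log (1 + Real.log u) := by
      rw [Real.log_div (by positivity) (by norm_num)]
      refine Real.log_le_log (by linarith [Real.log_two_lt_d9]) (by linarith)
    linarith
  · have h112 : 0 < Real.log 1.12 := Real.log_pos (by norm_num)
    have hlt : Real.log 1.12 ≤ 1 :=
      (Real.log_le_sub_one_of_pos (by norm_num)).trans (by norm_num)
    have he : Real.log (1.12 * u) = Real.log 1.12 + Real.log u :=
      Real.log_mul (by norm_num) (by positivity)
    have h125 : Real.log 125 ≤ 7 * Real.log 2 := by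
      rw [← Real.log_rpow (by norm_num)]
      exact Real.log_le_log (by norm_num) (by norm_num)
    have hloglog : Real.log (Real.log (1.12 * u)) ≤ Real.log (1 + Real.log u) :=
      Real.log_le_log (by linarith) (by linarith)
    have : betaAll u (δ / n) =
        2 * (Real.log 125 + Real.log (Real.log (1.12 * u)) + Λ) := by
      rw [betaAll, mul_div_assoc, div_eq_mul_one_div (Real.log _), ← mul_assoc, Real.log_mul
        (by rw [he]; positivity) (by positivity), Real.log_mul (by norm_num) (by linarith), hinv]
    rw [this]
    linarith

/-- Lower bounds for the two logarithmic factors of the complexity. -/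
theorem quarter_le_log_log {Δ : ℝ} (h0 : 0 < Δ) (h1 : Δ < 1) :
    1 ≤ 2 * Real.log (2 / Δ) ∧ 1 / 4 ≤ Real.log (2 * Real.log (2 / Δ)) := by
  have hlog2 := Real.log_two_gt_d9
  have hD : Real.log 2 ≤ Real.log (2 / Δ) := by
    refine Real.log_le_log (by norm_num) ?_
    rw [le_div_iff₀ h0]; linarith
  refine ⟨by linarith, ?_⟩
  have := Real.one_sub_inv_le_log_of_pos (x := 1.38) (by norm_num)
  have h2 := Real.log_le_log (x := 1.38) (y := 2 * Real.log (2 / Δ)) (by norm_num) (by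
    norm_num; linarith)
  refine le_trans ?_ (this.trans h2)
  norm_num

theorem half_le_log_div {δ : ℝ} (hδ0 : 0 < δ) (hδ1 : δ < 1) (hn : 2 ≤ n) :
    1 / 2 ≤ Real.log (n / δ) := by
  have hn' : (2 : ℝ) ≤ n := by exact_mod_cast hn
  have : Real.log 2 ≤ Real.log (n / δ) := by
    refine Real.log_le_log (by norm_num) ?_
    rw [le_div_iff₀ hδ0]; nlinarith
  linarith [Real.log_two_gt_d9]

theorem one_le_mul_gapCost {δ : ℝ} (hδ0 : 0 < δ) (hδ1 : δ < 1) (hn : 2 ≤ n) {Δ : ℝ} (h0 : 0 < Δ)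
    (h1 : Δ < 1) : 1 ≤ 8 * (Real.log (n / δ) * gapCost Δ) := by
  have hΛ := half_le_log_div hδ0 hδ1 hn
  have hG : 1 / 4 ≤ gapCost Δ := by
    have := (quarter_le_log_log h0 h1).2
    rw [gapCost, le_div_iff₀ (by positivity)]
    nlinarith
  nlinarith

/-- Inversion of the confidence radius. With `v = u Δ²` the hypothesis reads
`v ≤ 162 β u`, where `β u` grows like `log (n / δ)` plus `log (log (2 / Δ) + log v)`; the `log v` is
absorbed into the left side. -/
theorem count_le_of_gap_le {β : ℕ → ℝ → ℝ} {δ : ℝ} (hβ : IsConfidence δ β) (hn : 2 ≤ n)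
    {Δ : ℝ} (h0 : 0 < Δ) (h1 : Δ < 1) {u : ℕ} (hu : 1 ≤ u) (hle : Δ ≤ 18 * alpha β n δ u) :
    (u : ℝ) ≤ 80000 * (Real.log (n / δ) * gapCost Δ) := by
  have hu' : (1 : ℝ) ≤ u := by exact_mod_cast hu
  set Λ := Real.log (n / δ) with hΛdef
  have hΛ : 1 / 2 ≤ Λ := half_le_log_div hβ.pos hβ.lt_one hn
  have hb := beta_le hβ hn hΛdef hu
  obtain ⟨hD, hG⟩ := quarter_le_log_log h0 h1
  set D := Real.log (2 / Δ) with hDdef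
  set G := Real.log (2 * D) with hGdef
  set v := u * Δ ^ 2 with hv
  have hv0 : 0 < v := by positivity
  have hvβ : v ≤ 162 * β u (δ / n) := by
    have hα : 0 < alpha β n δ u := by linarith
    have hsq : alpha β n δ u ^ 2 = β u (δ / n) / (2 * u) := Real.sq_sqrt (Real.sqrt_pos.1 hα).le
    have h2 : Δ ^ 2 ≤ (18 * alpha β n δ u) ^ 2 := by gcongr
    rw [mul_pow, hsq] at h2
    have h3 := mul_le_mul_of_nonneg_left h2 (by positivity : (0 : ℝ) ≤ u)
    rw [hv]
    refine h3.trans (le_of_eq ?_)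
    field_simp; ring
  have hlogu : Real.log u = Real.log v + 2 * D - 2 * Real.log 2 := by
    rw [hv, Real.log_mul (by positivity) (by positivity), Real.log_pow, hDdef,
      Real.log_div (by norm_num) h0.ne']
    push_cast; ring
  have hlogu0 : 0 ≤ Real.log u := Real.log_nonneg hu'
  have hone : 1 + Real.log u ≤ Real.log v + 2 * D := by
    rw [hlogu]; linarith [Real.log_two_gt_d9]
  have h648 : Real.log 648 ≤ 20 * Λ := by
    have e : Real.log 648 ≤ 10 * Real.log 2 := by
      rw [← Real.log_rpow (by norm_num)]
      exact Real.log_le_log (by norm_num) (by norm_num)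
    linarith [Real.log_two_lt_d9]
  have hlogv : Real.log v ≤ v / 648 + 20 * Λ := by
    have := Real.log_le_sub_one_of_pos (x := v / 648) (by positivity)
    rw [Real.log_div hv0.ne' (by norm_num)] at this
    linarith
  have hll : Real.log (1 + Real.log u) ≤ G + (v / 648 + 20 * Λ) := by
    rcases le_total (Real.log v) 0 with hneg | hpos
    · have : Real.log (1 + Real.log u) ≤ G := Real.log_le_log (by linarith) (by linarith)
      have : 0 ≤ v / 648 := by positivity
      linarith
    · have h2 : Real.log (1 + Real.log u) ≤ Real.log ((1 + Real.log v) * (2 * D)) :=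
        Real.log_le_log (by linarith) (by nlinarith)
      rw [Real.log_mul (by linarith) (by linarith)] at h2
      have h3 := Real.log_le_sub_one_of_pos (x := 1 + Real.log v) (by linarith)
      linarith
  have hvle : v ≤ 80000 * (Λ * G) := by
    have hlin : v ≤ 18144 * Λ + 648 * G := by linarith
    nlinarith
  rw [gapCost, ← hDdef, ← hGdef, ← mul_div_assoc, ← mul_div_assoc, le_div_iff₀ (by positivity)]
  exact hvle

/-! ### The total number of comparisons -/

/-- The `2h` ranks strictly between `top` and `bot` give the last term of the complexity. -/
theorem sum_gapCost_itemGap (M : Matrix (Fin n) (Fin n) ℝ) (π : Equiv.Perm (Fin n))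
    {k h : ℕ} (hhk : h < k) {top bot : Fin n} (htop : top.val + 1 = k - h)
    (hbot : bot.val + 1 = k + 1 + h) (δ : ℝ) :
    Real.log (n / δ) * ∑ r, gapCost (itemGap M π top bot r) = complexity M π h δ top bot := by
  have hlt : top < bot := by rw [Fin.lt_def]; omega
  have hmid : (Finset.univ.filter fun r => ¬ r ≤ top).filter (fun r => ¬ bot ≤ r) =
      Finset.Ioo top bot := by
    ext r; simp
  have hbotf : (Finset.univ.filter fun r => ¬ r ≤ top).filter (fun r => bot ≤ r) =
      Finset.univ.filter fun r => bot ≤ r := by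
    ext r
    simp only [Finset.mem_filter, Finset.mem_univ, true_and, not_le, and_iff_right_iff_imp]
    exact fun hr => hlt.trans_le hr
  have hcard : ((Finset.Ioo top bot).card : ℝ) = 2 * h := by
    rw [Fin.card_Ioo]
    have : bot.val - top.val - 1 = 2 * h := by omega
    rw [this]; push_cast; ring
  simp only [itemGap, apply_ite gapCost]
  rw [complexity, Finset.sum_ite, Finset.sum_ite, hbotf, hmid, Finset.sum_const, nsmul_eq_mul,
    hcard, add_assoc]

theorem itemGap_mem_Ioo (hn : 2 ≤ n) {M : Matrix (Fin n) (Fin n) ℝ} (hM : M ∈ comparisonClass n 0)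
    {π : Equiv.Perm (Fin n)} (hπ : IsSorting (score M) π) {top bot : Fin n}
    (hgap : 0 < gap M π top bot) (r : Fin n) :
    itemGap M π top bot r ∈ Set.Ioo (0 : ℝ) 1 := by
  have hlt : ∀ i j, gap M π i j < 1 := fun i j => by
    have h1 := (score_mem_Ioo hn hM (π i)).2
    have h2 := (score_mem_Ioo hn hM (π j)).1
    rw [gap]; linarith
  unfold itemGap
  split_ifs with h1 h2
  · refine ⟨hgap.trans_le ?_, hlt _ _⟩
    have := hπ h1
    simp only [gap]; linarith
  · refine ⟨hgap.trans_le ?_, hlt _ _⟩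
    have := hπ h2
    simp only [gap]; linarith
  · exact ⟨hgap, hlt _ _⟩

/-- The bound on the number of comparisons holds on the whole event `Concentrated`; in particular
the algorithm stops there. -/
theorem exists_stopsAt_comparisons_le {k h : ℕ} (hhk : h < k) (hkn : k + 1 + h ≤ n)
    {M : Matrix (Fin n) (Fin n) ℝ} (hM : M ∈ comparisonClass n 0)
    {π : Equiv.Perm (Fin n)} (hπ : IsSorting (score M) π) {δ : ℝ} {β : ℕ → ℝ → ℝ}
    (hβ : IsConfidence δ β) (R : Rule n k h (alpha β n δ)) {top bot : Fin n}
    (htop : top.val + 1 = k - h) (hbot : bot.val + 1 = k + 1 + h) (hgap : 0 < gap M π top bot)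
    {ω : Outcomes n} (hω : Concentrated M (alpha β n δ) (ranked π 1 k) ω) :
    ∃ t, R.StopsAt ω t ∧ (R.comparisons ω t : ℝ) ≤ 160024 * complexity M π h δ top bot := by
  have hn : 2 ≤ n := by omega
  set K : Fin n → ℝ := fun r => Real.log (n / δ) * gapCost (itemGap M π top bot r) with hK
  have hK1 : ∀ r, 1 ≤ 8 * K r := fun r =>
    one_le_mul_gapCost hβ.pos hβ.lt_one hn (itemGap_mem_Ioo hn hM hπ hgap r).1
      (itemGap_mem_Ioo hn hM hπ hgap r).2
  have hfaith := R.faithful_state ω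
  obtain ⟨t, ht, hle⟩ := R.exists_stopsAt ω (fun b => ⌊80000 * K (π.symm b)⌋₊) fun t hnot => by
    obtain ⟨b, hb, hbgap⟩ := exists_itemGap_le hπ hω htop hbot (hfaith t)
      (R.isSelection t (R.state ω t)) (not_le.1 hnot)
    refine ⟨b, hb, Nat.le_floor ?_⟩
    exact count_le_of_gap_le hβ hn (itemGap_mem_Ioo hn hM hπ hgap _).1
      (itemGap_mem_Ioo hn hM hπ hgap _).2 (hfaith t b).1 hbgap
  refine ⟨t, ht, ?_⟩
  have hsumK : ∑ b, K (π.symm b) = complexity M π h δ top bot := by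
    rw [Equiv.sum_comp π.symm K, ← sum_gapCost_itemGap M π hhk htop hbot, Finset.mul_sum]
  have hfloor : ∀ b, (⌊80000 * K (π.symm b)⌋₊ : ℝ) ≤ 80000 * K (π.symm b) := fun b =>
    Nat.floor_le (by linarith [hK1 (π.symm b)])
  have hcast : (R.comparisons ω t : ℝ) ≤
      n + 2 * ∑ b, ((⌊80000 * K (π.symm b)⌋₊ : ℝ) + 1) := by exact_mod_cast hle
  -- each of the `n` summands costs `3 ≤ 24 K` besides the `2 * 80000 K` from the rounds
  calc (R.comparisons ω t : ℝ) ≤ n + 2 * ∑ b, ((⌊80000 * K (π.symm b)⌋₊ : ℝ) + 1) := hcast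
    _ = ∑ b, (3 + 2 * (⌊80000 * K (π.symm b)⌋₊ : ℝ)) := by
        simp only [Finset.sum_add_distrib, ← Finset.mul_sum, Finset.sum_const, Finset.card_univ,
          Fintype.card_fin, nsmul_eq_mul]
        ring
    _ ≤ ∑ b, 160024 * K (π.symm b) :=
        Finset.sum_le_sum fun b _ => by linarith [hfloor b, hK1 (π.symm b)]
    _ = _ := by rw [← Finset.mul_sum, hsumK]

/-- The event `A` is not assumed measurable: a tie-breaking rule is an arbitrary function of the
state. -/
theorem le_outcomesLaw_of_concentrated {n : ℕ} (hn : 2 ≤ n)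
    {M : Matrix (Fin n) (Fin n) ℝ}
    (hM : M ∈ comparisonClass n 0) {δ : ℝ} {β : ℕ → ℝ → ℝ} (hβ : IsConfidence δ β)
    (S : Finset (Fin n)) {A : Set (Outcomes n)}
    (hA : ∀ ω, Concentrated M (alpha β n δ) S ω → ω ∈ A) :
    ENNReal.ofReal (1 - δ) ≤ outcomesLaw M A := by
  have := isProbabilityMeasure_outcomesLaw hn hM
  rw [ENNReal.ofReal_sub _ hβ.pos.le, ENNReal.ofReal_one, tsub_le_iff_right]
  calc (1 : ENNReal) = outcomesLaw M Set.univ := measure_univ.symm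
    _ ≤ outcomesLaw M A + outcomesLaw M {ω | ¬ Concentrated M (alpha β n δ) S ω} := by
        refine (measure_mono fun ω _ => ?_).trans (measure_union_le _ _)
        by_cases h : Concentrated M (alpha β n δ) S ω
        · exact Or.inl (hA ω h)
        · exact Or.inr h
    _ ≤ _ := by gcongr; exact measure_not_concentrated_le hn hM hβ S

end HammingLUCB

end

theorem theorem1 :
    ∃ C : ℝ, 0 < C ∧
      ∀ (n k h : ℕ) (_ : h < k) (_ : k + 1 + h ≤ n)
        (M : Matrix (Fin n) (Fin n) ℝ) (_ : M ∈ HammingLUCB.comparisonClass n 0)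
        (π : Equiv.Perm (Fin n)) (_ : HammingLUCB.IsSorting (HammingLUCB.score M) π)
        (δ : ℝ) (β : ℕ → ℝ → ℝ)
        (_ : (0 < δ ∧ δ < 0.0005 ∧ β = HammingLUCB.betaSmall) ∨
          (0 < δ ∧ δ < 1 ∧ β = HammingLUCB.betaAll))
        (R : HammingLUCB.Rule n k h (HammingLUCB.alpha β n δ))
        -- the ranks `k - h` and `k + 1 + h`, as elements of `Fin n`
        (top bot : Fin n) (_ : top.val + 1 = k - h) (_ : bot.val + 1 = k + 1 + h),
        -- the probability of returning an inaccurate ranking is at most `δ`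
        HammingLUCB.outcomesLaw M {ω | ∃ t, R.StopsAt ω t ∧ ¬ R.AccurateAt π ω t}
            ≤ ENNReal.ofReal δ ∧
        (0 < HammingLUCB.gap M π top bot →
          -- with probability at least `1 - δ` an accurate ranking is returned
          ENNReal.ofReal (1 - δ) ≤
            HammingLUCB.outcomesLaw M {ω | ∃ t, R.StopsAt ω t ∧ R.AccurateAt π ω t} ∧
          -- with probability at least `1 - δ` there are not too many comparisons
          ENNReal.ofReal (1 - δ) ≤
            HammingLUCB.outcomesLaw M {ω | ∃ t, R.StopsAt ω t ∧
              (R.comparisons ω t : ℝ) ≤ C * HammingLUCB.complexity M π h δ top bot}) := by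
  refine ⟨160024, by norm_num, ?_⟩
  intro n k h hhk hkn M hM π hπ δ β hβ R top bot htop hbot
  have hn : 2 ≤ n := by omega
  have hβ' : HammingLUCB.IsConfidence δ β := hβ
  refine ⟨(measure_mono ?_).trans
    (HammingLUCB.measure_not_concentrated_le hn hM hβ' (HammingLUCB.ranked π 1 k)),
    fun hgap => ⟨?_, ?_⟩⟩
  · rintro ω ⟨t, ht, hacc⟩ hω
    exact hacc (R.accurateAt_of_terminated hπ hω ht.1)
  · refine HammingLUCB.le_outcomesLaw_of_concentrated hn hM hβ' (HammingLUCB.ranked π 1 k)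
      fun ω hω => ?_
    obtain ⟨t, ht, -⟩ := HammingLUCB.exists_stopsAt_comparisons_le hhk hkn hM hπ hβ' R htop hbot
      hgap hω
    exact ⟨t, ht, R.accurateAt_of_terminated hπ hω ht.1⟩
  · exact HammingLUCB.le_outcomesLaw_of_concentrated hn hM hβ' (HammingLUCB.ranked π 1 k)
      fun ω hω => HammingLUCB.exists_stopsAt_comparisons_le hhk hkn hM hπ hβ' R htop hbot hgap hω
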